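/- Let $G$ be a finitely presentable group which is a $2$-dimensional duality group over $\mathbb{Z}$; that is, the augmentation module $\mathbb{Z}$ has a resolution of length $2$ by finitely generated projective left $\mathbb{Z}[G]$-modules, $H^i(G;\mathbb{Z}[G])=0$ for $i<2$, and $H^2(G;\mathbb{Z}[G])$ is torsion free as an abelian group. Let $w:G\to\{\pm1\}$ be any homomorphism, and let $\Pi=E^2\mathbb{Z}$ be the left $\mathbb{Z}[G]$-module with underlying abelian group $H^2(G;\mathbb{Z}[G])$ and action $g\cdot x=w(g)\,x g^{-1}$ for $g\in G$, where $H^2(G;\mathbb{Z}[G])$ has the right $\mathbb{Z}[G]$-module structure induced by right multiplication on the coefficients. Give $\Pi\otimes\Pi=\Pi\otimes_{\mathbb{Z}}\Pi$ the diagonal left $G$-action. For $x\in H^2(G;\Pi)=\mathrm{Ext}^2_{\mathbb{Z}[G]}(\mathbb{Z},\Pi)$ let $x\cup \mathrm{id}_\Pi\in \mathrm{Ext}^2_{\mathbb{Z}[G]}(\Pi,\Pi\otimes\Pi)$ be the image of $x$ under the map $$\mathrm{Ext}^2_{\mathbb{Z}[G]}(\mathbb{Z},\Pi)\to \mathrm{Ext}^2_{\mathbb{Z}[G]}(\mathbb{Z}\otimes\Pi,\Pi\otimes\Pi)=\mathrm{Ext}^2_{\mathbb{Z}[G]}(\Pi,\Pi\otimes\Pi)$$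 induced by the functor $-\otimes\Pi$, which is exact since $\Pi$ is torsion free. (Equivalently, if $P_*$ and $Q_*$ are projective resolutions of $\mathbb{Z}$ and $\Pi$, $\eta:Q_0\to\Pi$ is the augmentation and $x$ is represented by the cocycle $\xi:P_2\to\Pi$, then $x\cup\mathrm{id}_\Pi$ is represented by the cocycle $\xi\otimes\eta$ on the resolution $P_*\otimes Q_*$ of $\Pi$.) Then the homomorphism $$c^2_{G,w}:H^2(G;\Pi)\to \mathrm{Ext}^2_{\mathbb{Z}[G]}(\Pi,\Pi\otimes\Pi),\qquad x\mapsto x\cup \mathrm{id}_\Pi,$$ is an isomorphism of abelian groups. -/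

import Mathlib

open CategoryTheory CategoryTheory.Limits CategoryTheory.Abelian
open scoped TensorProduct

universe u

noncomputable section

namespace DualityGroup

/-! ## Modules over a group ring

`Rep.{u} k G` is Mathlib's category of `k`-linear representations of `G`. It is equivalent to the
category of left `k[G]`-modules (`Rep.equivalenceModuleMonoidAlgebra`), so that `Ext` in it is `Ext`
over `k[G]`. The constructions are made for a commutative ring `k` and used for `k = ℤ`. -/

section Category

variable (k : Type) [CommRing k] (G : Type u) [Group G]

instance enoughProjectives_rep : EnoughProjectives (Rep.{u} k G) :=
  (Rep.equivalenceModuleMonoidAlgebra (k := k) (G := G)).enoughProjectives_iff.2 inferInstance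

instance hasExt_rep : HasExt.{u} (Rep.{u} k G) :=
  hasExt_of_enoughProjectives _

/-- The augmentation module `k`, with trivial action of `G` (lifted to the universe of `G`). -/
abbrev augmentationModule : Rep.{u} k G :=
  Rep.trivial k G (ULift.{u} k)

/-- The group ring `k[G]`, as a left module over itself. -/
abbrev groupRing : Rep.{u} k G :=
  Rep.leftRegular k G

variable {k G}

/-- The cohomology group `Hⁿ(G; A) = Extⁿ_{k[G]}(k, A)`. -/
abbrev Cohomology (A : Rep.{u} k G) (n : ℕ) : Type u :=
  Ext.{u} (augmentationModule k G) A n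

end Category

/-! ## The conjugate dual module `Eⁿ k` -/

section Dualizing

variable (k : Type) [CommRing k] {G : Type u} [Group G]

/-- Right multiplication by `g`, as an endomorphism of the left module `k[G]`. -/
def rightMul (g : G) : groupRing k G ⟶ groupRing k G :=
  Rep.leftRegularHom (groupRing k G) (MonoidAlgebra.single g 1)

lemma rightMul_single (g h : G) (a : k) :
    (rightMul k g).hom (MonoidAlgebra.single h a) = MonoidAlgebra.single (h * g) a := by
  simp [rightMul]

lemma rightMul_one : rightMul k (1 : G) = 𝟙 _ := by
  ext
  simp [rightMul]

lemma rightMul_mul (g h : G) : rightMul k (g * h) = rightMul k g ≫ rightMul k h := by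
  ext
  simp [rightMul, mul_assoc]

/-- For a character `w : G → {±1}`, the left `k[G]`-module `Eⁿ k`, the conjugate of the right module
`Hⁿ(G; k[G])`: an element `g` of `G` acts on the left by `g • x = x · ḡ` with `ḡ = w(g) g⁻¹`, where
the right action of `G` on `Hⁿ(G; k[G])` is induced by right multiplication on the coefficients. -/
def conjugateDual (w : G →* ℤˣ) (n : ℕ) : Rep.{u} k G :=
  Rep.of (X := Cohomology (groupRing k G) n)
    { toFun := fun g =>
        { toFun := fun x => (w g : ℤ) • x.comp (Ext.mk₀ (rightMul k g⁻¹)) (add_zero n)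
          map_add' := by intros; simp
          map_smul' := by
            intro a x
            simp only [Ext.smul_comp, RingHom.id_apply]
            exact smul_comm _ _ _ }
      map_one' := by
        ext x
        simp [rightMul_one]
      map_mul' := by
        intro g h
        ext x
        simp [rightMul_mul, mul_smul]
        exact smul_comm _ _ _ }

end Dualizing

/-! ## Tensor products with the diagonal action, and cup products -/

section Cup

variable {k : Type} [CommRing k] {G : Type u} [Group G]

/-- The tensor product `A ⊗ B` over `k`, with the diagonal action of `G`. -/
abbrev tensor (A B : Rep.{u} k G) : Rep.{u} k G :=
  Rep.of (A.ρ.tprod B.ρ)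

/-- The homomorphism `id_A ⊗ f`. -/
abbrev tensorLeftMap (A : Rep.{u} k G) {D B : Rep.{u} k G} (f : D ⟶ B) : tensor A D ⟶ tensor A B :=
  Rep.ofHom (f.hom.lTensor A.ρ)

/-- The functor `- ⊗ D`. -/
@[simps]
def tensorRightFunctor (D : Rep.{u} k G) : Rep.{u} k G ⥤ Rep.{u} k G where
  obj A := tensor A D
  map f := Rep.ofHom (f.hom.rTensor D.ρ)
  map_id A := by ext; simp
  map_comp f g := by ext; simp

instance tensorRightFunctor_additive (D : Rep.{u} k G) : (tensorRightFunctor D).Additive where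
  map_add {_ _ f g} := by
    ext1
    exact Representation.IntertwiningMap.tensor_add_left _ _ _

/-- The underlying `k`-module of `D` is flat. -/
class IsFlat (D : Rep.{u} k G) : Prop where
  flat : Module.Flat k D.V

/-- If `D` is flat over `k` then `- ⊗ D` is exact. -/
lemma tensorRightFunctor_exact (D : Rep.{u} k G) [IsFlat D] :
    PreservesFiniteLimits (tensorRightFunctor D) ∧
      PreservesFiniteColimits (tensorRightFunctor D) := by
  have := IsFlat.flat (D := D)
  refine ((tensorRightFunctor D).exact_tfae.out 0 3).1 fun S hS => ?_
  let F := forget₂ (Rep.{u} k G) (ModuleCat.{u} k)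
  have h1 := hS.map_of_exact F
  have hT := ShortComplex.ShortExact.moduleCat_exact_iff_function_exact (S.map F)
  have hf : Function.Injective S.f.hom.toLinearMap := (ModuleCat.mono_iff_injective _).1 h1.mono_f
  have hg : Function.Surjective S.g.hom.toLinearMap := (ModuleCat.epi_iff_surjective _).1 h1.epi_g
  have he : Function.Exact S.f.hom.toLinearMap S.g.hom.toLinearMap := hT.1 h1.exact
  have h2 : ((S.map (tensorRightFunctor D)).map F).ShortExact :=
    { exact := (ShortComplex.ShortExact.moduleCat_exact_iff_function_exact _).2
        (rTensor_exact D.V he hg)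
      mono_f := (ModuleCat.mono_iff_injective _).2
        (Module.Flat.rTensor_preserves_injective_linearMap (M := D.V) _ hf)
      epi_g := (ModuleCat.epi_iff_surjective _).2 (LinearMap.rTensor_surjective D.V hg) }
  have hm : Mono (F.map (S.map (tensorRightFunctor D)).f) := h2.mono_f
  have hp : Epi (F.map (S.map (tensorRightFunctor D)).g) := h2.epi_g
  exact
    { exact := (ShortComplex.exact_map_iff_of_faithful _ F).1 h2.exact
      mono_f := F.mono_of_mono_map hm
      epi_g := F.epi_of_epi_map hp }

instance (D : Rep.{u} k G) [IsFlat D] : PreservesFiniteLimits (tensorRightFunctor D) :=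
  (tensorRightFunctor_exact D).1

instance (D : Rep.{u} k G) [IsFlat D] : PreservesFiniteColimits (tensorRightFunctor D) :=
  (tensorRightFunctor_exact D).2

/-- The canonical isomorphism `D ≅ k ⊗ D`. -/
def leftUnit (D : Rep.{u} k G) : D ≅ tensor (augmentationModule k G) D :=
  Rep.mkIso (.mk ((TensorProduct.lid k D.V).symm ≪≫ₗ
    TensorProduct.congr ULift.moduleEquiv.symm (LinearEquiv.refl k D.V)) (by
      intro g
      ext x
      simp))

lemma leftUnit_hom_apply (D : Rep.{u} k G) (x : D.V) :
    (leftUnit D).hom.hom x = (ULift.up (1 : k)) ⊗ₜ[k] x := rfl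

/-- The cup product `Hᵖ(G; A) × Hom_G(D, B) → Extᵖ_{k[G]}(D, A ⊗ B)`, for `D` flat over `k`:
`x ∪ f` is the product `x ⊗ f` of the classes `x ∈ Extᵖ(k, A)` and `f ∈ Ext⁰(D, B)` in
`Extᵖ(k ⊗ D, A ⊗ B)`, read off along `D ≅ k ⊗ D`. Here `x ⊗ f` is the composite of
`x ⊗ id_D ∈ Extᵖ(k ⊗ D, A ⊗ D)`, the image of `x` under the exact functor `- ⊗ D`, with
`id_A ⊗ f : A ⊗ D → A ⊗ B`. If `ξ : P_p → A` is a cocycle on a projective resolution `P` of `k`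
that represents `x`, and `Q` is a projective resolution of `D` with augmentation `η : Q₀ → D`, then
`x ∪ f` is represented by the cocycle `ξ ⊗ fη` on the resolution `P ⊗ Q` of `D`. -/
def cup {A D B : Rep.{u} k G} [IsFlat D] {p : ℕ} (x : Cohomology A p) (f : D ⟶ B) :
    Ext.{u} D (tensor A B) p :=
  (Ext.mk₀ (leftUnit D).hom).comp
    ((x.mapExactFunctor (tensorRightFunctor D)).comp (Ext.mk₀ (tensorLeftMap A f)) (add_zero p))
    (zero_add p)

lemma cup_add {A D B : Rep.{u} k G} [IsFlat D] {p : ℕ} (x y : Cohomology A p)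
    (f : D ⟶ B) : cup (x + y) f = cup x f + cup y f := by
  simp only [cup, Ext.mapExactFunctor_add, Ext.add_comp]
  exact Ext.comp_add _ _ _ _

end Cup

/-! ## Duality groups and the homomorphism `c_{G,w}` -/

section Duality

variable {G : Type u} [Group G]

/-- `G` is an `n`-dimensional duality group over `ℤ`: the augmentation module `ℤ` has a resolution
of length `n` by finitely generated projective `ℤ[G]`-modules, `Hⁱ(G; ℤ[G]) = 0` for `i < n`, and
`Hⁿ(G; ℤ[G])` is torsion free as an abelian group. -/
structure IsDualityGroup (G : Type u) [Group G] (n : ℕ) : Prop where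
  exists_resolution : ∃ P : ProjectiveResolution (augmentationModule ℤ G),
    (∀ i, Module.Finite (MonoidAlgebra ℤ G) (Rep.toModuleMonoidAlgebra.obj (P.complex.X i))) ∧
      ∀ i, n < i → IsZero (P.complex.X i)
  subsingleton_cohomology : ∀ i < n, Subsingleton (Cohomology (groupRing ℤ G) i)
  torsionFree : IsAddTorsionFree (Cohomology (groupRing ℤ G) n)

lemma IsDualityGroup.flat {n : ℕ} (hG : IsDualityGroup G n) (w : G →* ℤˣ) :
    IsFlat (conjugateDual ℤ w n) := by
  have h : IsAddTorsionFree (conjugateDual ℤ w n).V := hG.torsionFree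
  have hf : Module.Flat ℤ (conjugateDual ℤ w n).V := inferInstance
  have he : (conjugateDual ℤ w n).hV2 = AddCommGroup.toIntModule _ :=
    AddCommGroup.uniqueIntModule.uniq _
  exact ⟨he ▸ hf⟩

/-- The homomorphism `cⁿ_{G,w} : Hⁿ(G; Π) → Extⁿ_{ℤ[G]}(Π, Π ⊗ Π)`, `x ↦ x ∪ id_Π`, where
`Π = Eⁿ ℤ`. -/
def cupId {n : ℕ} (hG : IsDualityGroup G n) (w : G →* ℤˣ) :
    Cohomology (conjugateDual ℤ w n) n →+
      Ext.{u} (conjugateDual ℤ w n) (tensor (conjugateDual ℤ w n) (conjugateDual ℤ w n)) n :=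
  haveI := hG.flat w
  AddMonoidHom.mk' (fun x => cup x (𝟙 (conjugateDual ℤ w n))) fun x y => cup_add x y _

end Duality

end DualityGroup

end

/-!
Let `Π = E² ℤ`, and let `0 ⟶ P₂ ⟶ P₁ ⟶ P₀ ⟶ ℤ ⟶ 0` be a resolution of `ℤ` by finitely generated
projective modules, with Yoneda class `u ∈ Ext²(ℤ, P₂)`. The argument works over any commutative
ring `k` for which `Π` is flat, and for any flat module of coefficients `A` (`cup_id_bijective`); in
the theorem, `k = ℤ` and `A = Π`.

*Duality.* Since `Hⁱ(G; k[G]) = 0` for `i < 2`, the conjugate dual complex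
`0 ⟶ P₀* ⟶ P₁* ⟶ P₂* ⟶ Π ⟶ 0` is again a projective resolution, with class
`v ∈ Ext²(Π, P₀*)` (`dualResolution`, `dualClass`). Hence every class in `Ext²(k, A)` is of the form
`u · f` with `f : P₂ ⟶ A`, and vanishes if and only if `f` factors through `P₁`; every class in
`Ext²(Π, Y)` is of the form `v · μ` with `μ : P₀* ⟶ Y`, and vanishes if and only if `μ` factors
through `P₁*`. The finiteness of the resolution gives isomorphisms
`X ⊗ Π ≅ H²(G; k[G] ⊗ X)` (`kappa_bijective`) and, from these, for `P` finitely generated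
projective, `Hom(P*, X ⊗ Π) ≅ H²(G; P ⊗ X)` (`homDualOfClass_bijective`), natural in `P` and `X`.

*The cup product.* The product `u ∪ id` is the class of the exact sequence `P ⊗ Π`, so it equals
`v · λ₂` for any map of resolutions `λ : P* ⟶ P ⊗ Π` over the identity of `Π`. By duality the
components `λᵢ : P₂₋ᵢ* ⟶ Pᵢ ⊗ Π` are classes in `H²(G; P₂₋ᵢ ⊗ Pᵢ)`. These are supplied, up to
sign, by the three components of degree two of a diagonal approximation `Δ : P ⟶ P ⊗ P`
(`exists_diagonal_classes`): the equation `∂Δ = Δ∂` says that `λ` is a map of complexes, the counit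
property `(id ⊗ ε)Δ ≃ id` says that it covers the identity of `Π`, and the counit property
`(ε ⊗ id)Δ ≃ id` says that the class `y ∈ H²(G; P₀ ⊗ P₂)` corresponding to `-λ₂` is carried to `u`
by `ε ⊗ id`.

*Bijectivity.* It follows that `(u · f) ∪ id = -v · μ`, where `μ : P₀* ⟶ A ⊗ Π` corresponds to
`(id ⊗ f)(y) ∈ H²(G; P₀ ⊗ A)`, a class that `ε ⊗ id` carries to `u · f`. By duality `Ext²(Π, A ⊗ Π)`
is the cokernel of `H²(G; P₁ ⊗ A) ⟶ H²(G; P₀ ⊗ A)`, and by right exactness of `H²(G; -)` the map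
`ε ⊗ id` identifies this cokernel with `H²(G; A)`. Under this identification the cup product with
`id` is multiplication by `-1`.
-/

/-! ### Exact sequences of length two and their classes in `Ext²` -/

universe v w v' w'

/-- An exact sequence `0 ⟶ P₂ ⟶ P₁ ⟶ P₀ ⟶ Z ⟶ 0`, given as the splice of the short exact sequences
`0 ⟶ P₂ ⟶ P₁ ⟶ B ⟶ 0` and `0 ⟶ B ⟶ P₀ ⟶ Z ⟶ 0`. -/
structure TwoExtension {C : Type v} [Category.{w} C] [Abelian C] (Z : C) where
  {P₀ P₁ P₂ B : C}
  /-- The differential `P₂ ⟶ P₁`. -/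
  d₂ : P₂ ⟶ P₁
  /-- The epimorphism in the factorization `P₁ ⟶ B ⟶ P₀` of the other differential. -/
  p : P₁ ⟶ B
  /-- The monomorphism in the factorization `P₁ ⟶ B ⟶ P₀` of the other differential. -/
  i : B ⟶ P₀
  /-- The augmentation `P₀ ⟶ Z`. -/
  ε : P₀ ⟶ Z
  d₂_p : d₂ ≫ p = 0
  i_ε : i ≫ ε = 0
  exact₁ : (ShortComplex.mk d₂ p d₂_p).ShortExact
  exact₀ : (ShortComplex.mk i ε i_ε).ShortExact

namespace TwoExtension

variable {C : Type v} [Category.{w} C] [Abelian C] {Z : C} (R : TwoExtension Z)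

/-- The differential `P₁ ⟶ P₀`. -/
def d₁ : R.P₁ ⟶ R.P₀ := R.p ≫ R.i

instance : Epi R.p := R.exact₁.epi_g

instance : Mono R.i := R.exact₀.mono_f

instance : Epi R.ε := R.exact₀.epi_g

instance : Mono R.d₂ := R.exact₁.mono_f

lemma d₂_d₁ : R.d₂ ≫ R.d₁ = 0 := by
  rw [d₁, ← Category.assoc, R.d₂_p, zero_comp]

lemma d₁_ε : R.d₁ ≫ R.ε = 0 := by
  rw [d₁, Category.assoc, R.i_ε, comp_zero]

lemma exact_d₁_ε : (ShortComplex.mk R.d₁ R.ε R.d₁_ε).Exact :=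
  (ShortComplex.exact_iff_of_epi_of_isIso_of_mono
    (S₁ := ShortComplex.mk R.d₁ R.ε R.d₁_ε) (S₂ := ShortComplex.mk R.i R.ε R.i_ε)
    { τ₁ := R.p, τ₂ := 𝟙 _, τ₃ := 𝟙 _, comm₁₂ := by simp [d₁] }).2 R.exact₀.exact

lemma exists_lift_d₁ {X : C} [Projective X] (f : X ⟶ R.P₀) (hf : f ≫ R.ε = 0) :
    ∃ g, g ≫ R.d₁ = f := by
  refine ⟨Projective.factorThru (R.exact₀.exact.lift f hf) R.p, ?_⟩
  rw [d₁, Projective.factorThru_comp_assoc]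
  exact R.exact₀.exact.lift_f f hf

lemma exists_lift_d₂ {X : C} (f : X ⟶ R.P₁) (hf : f ≫ R.d₁ = 0) : ∃ g, g ≫ R.d₂ = f := by
  have hp : f ≫ R.p = 0 := by
    rw [← cancel_mono R.i, zero_comp, Category.assoc]
    exact hf
  exact ⟨R.exact₁.exact.lift f hp, R.exact₁.exact.lift_f f hp⟩

/-- An exact sequence `P₂ ⟶ P₁ ⟶ P₀ ⟶ Z` with a monomorphism at its left end and an epimorphism at
its right end, as a two-fold extension. -/
noncomputable def ofExact {P₀ P₁ P₂ : C} (d₂ : P₂ ⟶ P₁) (d₁ : P₁ ⟶ P₀) (ε : P₀ ⟶ Z)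
    (w₁ : d₂ ≫ d₁ = 0) (w₀ : d₁ ≫ ε = 0) (h₁ : (ShortComplex.mk d₂ d₁ w₁).Exact)
    (h₀ : (ShortComplex.mk d₁ ε w₀).Exact) [Mono d₂] [Epi ε] : TwoExtension Z where
  P₀ := P₀
  P₁ := P₁
  P₂ := P₂
  B := kernel ε
  d₂ := d₂
  p := kernel.lift ε d₁ w₀
  i := kernel.ι ε
  ε := ε
  d₂_p := by rw [← cancel_mono (kernel.ι ε)]; simpa using w₁
  i_ε := kernel.condition ε
  exact₁ := by
    have he : Epi (kernel.lift ε d₁ w₀) := h₀.epi_kernelLift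
    refine ⟨?_⟩
    refine (ShortComplex.exact_iff_of_epi_of_isIso_of_mono
      (S₁ := ShortComplex.mk d₂ (kernel.lift ε d₁ w₀) _) (S₂ := ShortComplex.mk d₂ d₁ w₁)
      { τ₁ := 𝟙 _, τ₂ := 𝟙 _, τ₃ := kernel.ι ε }).2 h₁
  exact₀ :=
    { exact := ShortComplex.exact_of_f_is_kernel _ (kernelIsKernel ε) }

lemma ofExact_d₁ {P₀ P₁ P₂ : C} (d₂ : P₂ ⟶ P₁) (d₁ : P₁ ⟶ P₀) (ε : P₀ ⟶ Z)
    (w₁ : d₂ ≫ d₁ = 0) (w₀ : d₁ ≫ ε = 0) (h₁ : (ShortComplex.mk d₂ d₁ w₁).Exact)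
    (h₀ : (ShortComplex.mk d₁ ε w₀).Exact) [Mono d₂] [Epi ε] :
    (ofExact d₂ d₁ ε w₁ w₀ h₁ h₀).d₁ = d₁ :=
  kernel.lift_ι _ _ _

/-- The image of a two-fold extension under an exact functor. -/
def map {D : Type v'} [Category.{w'} D] [Abelian D] (F : C ⥤ D) [F.Additive]
    [PreservesFiniteLimits F] [PreservesFiniteColimits F] : TwoExtension (F.obj Z) where
  P₀ := F.obj R.P₀
  P₁ := F.obj R.P₁
  P₂ := F.obj R.P₂
  B := F.obj R.B
  d₂ := F.map R.d₂
  p := F.map R.p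
  i := F.map R.i
  ε := F.map R.ε
  d₂_p := by rw [← F.map_comp, R.d₂_p, F.map_zero]
  i_ε := by rw [← F.map_comp, R.i_ε, F.map_zero]
  exact₁ := R.exact₁.map_of_exact F
  exact₀ := R.exact₀.map_of_exact F

lemma map_d₁ {D : Type v'} [Category.{w'} D] [Abelian D] (F : C ⥤ D) [F.Additive]
    [PreservesFiniteLimits F] [PreservesFiniteColimits F] : (R.map F).d₁ = F.map R.d₁ :=
  (F.map_comp _ _).symm

section Class

variable [HasExt.{u} C]

/-- The Yoneda class in `Ext²(Z, P₂)` of a two-fold extension. -/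
noncomputable def cls : Ext.{u} Z R.P₂ 2 :=
  R.exact₀.extClass.comp R.exact₁.extClass rfl

lemma mapExactFunctor_cls {D : Type v'} [Category.{w'} D] [Abelian D] [HasExt.{u} D] (F : C ⥤ D)
    [F.Additive] [PreservesFiniteLimits F] [PreservesFiniteColimits F] :
    R.cls.mapExactFunctor F = (R.map F).cls := by
  rw [cls, Ext.mapExactFunctor_comp, Ext.mapExactFunctor_extClass, Ext.mapExactFunctor_extClass]
  rfl

/-- A morphism of two-fold extensions relates their classes. -/
lemma cls_naturality {R : TwoExtension Z} {Z' : C} {R' : TwoExtension Z'} {f₂ : R.P₂ ⟶ R'.P₂}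
    {f₁ : R.P₁ ⟶ R'.P₁} {f₀ : R.P₀ ⟶ R'.P₀} {f : Z ⟶ Z'} (h₂ : R.d₂ ≫ f₁ = f₂ ≫ R'.d₂)
    (h₁ : R.d₁ ≫ f₀ = f₁ ≫ R'.d₁) (h₀ : R.ε ≫ f = f₀ ≫ R'.ε) :
    R.cls.comp (Ext.mk₀ f₂) (add_zero 2) = (Ext.mk₀ f).comp R'.cls (zero_add 2) := by
  have hw : R.d₂ ≫ f₁ ≫ R'.p = 0 := by
    rw [← Category.assoc, h₂, Category.assoc, R'.d₂_p, comp_zero]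
  let b : R.B ⟶ R'.B := R.exact₁.exact.desc (f₁ ≫ R'.p) hw
  have hb : R.p ≫ b = f₁ ≫ R'.p := R.exact₁.exact.g_desc (f₁ ≫ R'.p) hw
  have hb' : R.i ≫ f₀ = b ≫ R'.i := by
    rw [← cancel_epi R.p, ← Category.assoc, ← Category.assoc, hb]
    simpa [d₁] using h₁
  have n₁ := ShortComplex.ShortExact.extClass_naturality R.exact₁ R'.exact₁
    { τ₁ := f₂, τ₂ := f₁, τ₃ := b, comm₁₂ := h₂.symm, comm₂₃ := hb.symm }
  have n₀ := ShortComplex.ShortExact.extClass_naturality R.exact₀ R'.exact₀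
    { τ₁ := b, τ₂ := f₀, τ₃ := f, comm₁₂ := hb'.symm, comm₂₃ := h₀.symm }
  dsimp at n₁ n₀
  rw [cls, cls, Ext.comp_assoc_of_third_deg_zero, n₁, ← Ext.comp_assoc_of_second_deg_zero, n₀,
    Ext.comp_assoc _ _ _ (zero_add 1) rfl (by rfl)]

lemma cls_comp_d₂ {A : C} (h : R.P₁ ⟶ A) :
    R.cls.comp (Ext.mk₀ (R.d₂ ≫ h)) (add_zero 2) = 0 := by
  rw [← Ext.mk₀_comp_mk₀, cls, Ext.comp_assoc_of_third_deg_zero,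
    R.exact₁.extClass_comp_assoc (Ext.mk₀ h), Ext.comp_zero]

variable [Projective R.P₀]

lemma cls_comp_eq_zero_iff {A : C} (f : R.P₂ ⟶ A) :
    R.cls.comp (Ext.mk₀ f) (add_zero 2) = 0 ↔ ∃ h : R.P₁ ⟶ A, R.d₂ ≫ h = f := by
  refine ⟨fun hf => ?_, ?_⟩
  · rw [cls, Ext.comp_assoc_of_third_deg_zero] at hf
    obtain ⟨y, hy⟩ := Ext.contravariant_sequence_exact₁ R.exact₀ A _ rfl hf
    rw [Ext.eq_zero_of_projective y, Ext.comp_zero] at hy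
    obtain ⟨z, hz⟩ := Ext.contravariant_sequence_exact₁ R.exact₁ A _ rfl hy.symm
    obtain ⟨h, rfl⟩ := (Ext.mk₀_bijective _ _).2 z
    refine ⟨h, (Ext.mk₀_bijective _ _).1 ?_⟩
    rw [← hz]
    exact (Ext.mk₀_comp_mk₀ _ _).symm
  · rintro ⟨h, rfl⟩
    exact R.cls_comp_d₂ h

variable [Projective R.P₁]

lemma exists_eq_cls_comp {A : C} (x : Ext Z A 2) :
    ∃ f : R.P₂ ⟶ A, R.cls.comp (Ext.mk₀ f) (add_zero 2) = x := by
  obtain ⟨y, hy⟩ := Ext.contravariant_sequence_exact₃ R.exact₀ A x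
    (Ext.eq_zero_of_projective _) (n₀ := 1) rfl
  obtain ⟨z, hz⟩ := Ext.contravariant_sequence_exact₃ R.exact₁ A y
    (Ext.eq_zero_of_projective _) (n₀ := 0) rfl
  obtain ⟨f, rfl⟩ := (Ext.mk₀_bijective _ _).2 z
  refine ⟨f, ?_⟩
  rw [cls, Ext.comp_assoc_of_third_deg_zero, hz, hy]

/-- `Ext²(Z, -)` is right exact, since `Z` has projective dimension at most two. -/
lemma exists_comp_mk₀_eq_of_comp_eq_zero [Projective R.P₂] {A'' A A' : C} {s : A'' ⟶ A}
    {q : A ⟶ A'} (hw : s ≫ q = 0) (hs : (ShortComplex.mk s q hw).Exact) [Epi q] (x : Ext Z A 2)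
    (hx : x.comp (Ext.mk₀ q) (add_zero 2) = 0) :
    ∃ y : Ext Z A'' 2, y.comp (Ext.mk₀ s) (add_zero 2) = x := by
  obtain ⟨f, rfl⟩ := R.exists_eq_cls_comp x
  rw [Ext.comp_assoc_of_third_deg_zero, Ext.mk₀_comp_mk₀, cls_comp_eq_zero_iff] at hx
  obtain ⟨h, hh⟩ := hx
  have hk : (f - R.d₂ ≫ Projective.factorThru h q) ≫ q = 0 := by
    rw [Preadditive.sub_comp, Category.assoc, Projective.factorThru_comp, hh, sub_self]
  refine ⟨R.cls.comp (Ext.mk₀ (hs.liftFromProjective _ hk)) (add_zero 2), ?_⟩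
  have hl := hs.liftFromProjective_comp _ hk
  dsimp at hl
  rw [Ext.comp_assoc_of_third_deg_zero, Ext.mk₀_comp_mk₀, hl, sub_eq_add_neg, Ext.mk₀_add,
    Ext.comp_add, Ext.mk₀_neg, Ext.comp_neg, cls_comp_d₂, neg_zero, add_zero]

end Class

end TwoExtension

noncomputable section

namespace DualityGroup

/-! ### Finitely generated projective modules over a group ring -/

/-- The linear map out of `k[G]` with prescribed values on the elements of `G`. -/
def groupRingLift {k : Type} [CommRing k] {G : Type u} {M : Type*} [AddCommGroup M] [Module k M]
    (f : G → M) :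
    MonoidAlgebra k G →ₗ[k] M :=
  Finsupp.lift M k G f ∘ₗ (MonoidAlgebra.coeffLinearEquiv _).toLinearMap

@[simp]
lemma groupRingLift_single {k : Type} [CommRing k] {G : Type u} {M : Type*} [AddCommGroup M]
    [Module k M] (f : G → M) (g : G) (a : k) :
    groupRingLift f (MonoidAlgebra.single g a) = a • f g := by
  simp [groupRingLift]

section FiniteProjective

variable {k : Type} [CommRing k] {G : Type u} [Group G]

lemma groupRing_hom_single {X : Rep.{u} k G} (f : groupRing k G ⟶ X) (g : G) (a : k) :
    f.hom (MonoidAlgebra.single g a) = a • X.ρ g (f.hom (MonoidAlgebra.single 1 1)) := by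
  rw [← Rep.hom_comm_apply, ← map_smul, Representation.ofMulAction_single, smul_eq_mul, mul_one,
    MonoidAlgebra.smul_single, smul_eq_mul, mul_one]

lemma groupRing_hom_ext {X : Rep.{u} k G} {f f' : groupRing k G ⟶ X}
    (h : f.hom (MonoidAlgebra.single 1 1) = f'.hom (MonoidAlgebra.single 1 1)) : f = f' := by
  ext g
  dsimp
  rw [groupRing_hom_single f, groupRing_hom_single f', h]

lemma leftRegularHom_one {X : Rep.{u} k G} (x : X.V) :
    (Rep.leftRegularHom X x).hom (MonoidAlgebra.single 1 1) = x := by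
  simp

lemma leftRegularHom_comp {X Y : Rep.{u} k G} (x : X.V) (f : X ⟶ Y) :
    Rep.leftRegularHom X x ≫ f = Rep.leftRegularHom Y (f.hom x) := by
  apply groupRing_hom_ext
  simp

lemma leftRegularHom_add {X : Rep.{u} k G} (x y : X.V) :
    Rep.leftRegularHom X (x + y) = Rep.leftRegularHom X x + Rep.leftRegularHom X y := by
  apply groupRing_hom_ext
  simp [Rep.add_hom]

lemma leftRegularHom_smul {X : Rep.{u} k G} (a : k) (x : X.V) :
    Rep.leftRegularHom X (a • x) = a • Rep.leftRegularHom X x := by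
  apply groupRing_hom_ext
  simp [Rep.smul_hom]

lemma exists_eq_leftRegularHom {X : Rep.{u} k G} (f : groupRing k G ⟶ X) :
    ∃ x, f = Rep.leftRegularHom X x :=
  ⟨f.hom (MonoidAlgebra.single 1 1), groupRing_hom_ext (by simp)⟩

/-- The endomorphisms of the left module `k[G]` are the linear combinations of right
multiplications. -/
lemma groupRing_end_induction {motive : (groupRing k G ⟶ groupRing k G) → Prop}
    (hadd : ∀ r s, motive r → motive s → motive (r + s))
    (hsmul : ∀ (a : k) r, motive r → motive (a • r)) (hr : ∀ g, motive (rightMul k g))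
    (r : groupRing k G ⟶ groupRing k G) : motive r := by
  obtain ⟨x, rfl⟩ := exists_eq_leftRegularHom r
  induction x using MonoidAlgebra.induction_on with
  | of g => exact hr g
  | add x y hx hy => rw [leftRegularHom_add]; exact hadd _ _ hx hy
  | smul a x hx => rw [leftRegularHom_smul]; exact hsmul _ _ hx

instance projective_groupRing : Projective (groupRing k G) where
  factors {E X} f e he := by
    obtain ⟨x, hx⟩ := (Rep.epi_iff_surjective e).1 he (f.hom (MonoidAlgebra.single 1 1))
    exact ⟨Rep.leftRegularHom E x, groupRing_hom_ext (by simp [hx])⟩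

/-- A `k[G]`-module is finitely generated projective if it has a finite dual basis, that is, if its
identity is a finite sum of endomorphisms that factor through `k[G]`. -/
class FiniteProjective (P : Rep.{u} k G) : Prop where
  exists_dualBasis (P) : ∃ (n : ℕ) (q : Fin n → (P ⟶ groupRing k G))
    (p : Fin n → (groupRing k G ⟶ P)), ∑ j, q j ≫ p j = 𝟙 P

instance FiniteProjective.projective (P : Rep.{u} k G) [FiniteProjective P] : Projective P where
  factors {E X} f e he := by
    obtain ⟨n, q, p, h⟩ := exists_dualBasis P
    refine ⟨∑ j, q j ≫ Projective.factorThru (p j ≫ f) e, ?_⟩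
    simp only [Preadditive.sum_comp, Category.assoc, Projective.factorThru_comp]
    simp only [← Category.assoc, ← Preadditive.sum_comp, h, Category.id_comp]

lemma FiniteProjective.of_finite (P : Rep.{u} k G) [Projective P]
    [h : Module.Finite (MonoidAlgebra k G) (Rep.toModuleMonoidAlgebra.obj P)] :
    FiniteProjective P := by
  obtain ⟨n, x, hx⟩ : ∃ (n : ℕ) (x : Fin n → P.V), Submodule.span (MonoidAlgebra k G)
      (M := Rep.toModuleMonoidAlgebra.obj P) (Set.range x) = ⊤ :=
    Module.Finite.exists_fin (M := Rep.toModuleMonoidAlgebra.obj P)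
  let p (j : Fin n) : groupRing k G ⟶ P := Rep.leftRegularHom P (x j)
  have : HasFiniteBiproducts (Rep.{u} k G) := Abelian.hasFiniteBiproducts
  -- The generators `x` give an epimorphism from a free module, which splits.
  have : Epi (biproduct.desc p) := by
    refine Preadditive.epi_of_cancel_zero _ fun {Y} g hg => ?_
    have h0 (j : Fin n) : g.hom (x j) = 0 := by
      have hj : p j ≫ g = 0 := by
        rw [← biproduct.ι_desc p j, Category.assoc, hg, comp_zero]
      have := congr((Rep.Hom.hom $hj) (MonoidAlgebra.single 1 1))
      rwa [show p j = Rep.leftRegularHom P (x j) from rfl, leftRegularHom_comp,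
        leftRegularHom_one] at this
    apply Rep.toModuleMonoidAlgebra.map_injective
    ext1
    refine LinearMap.ext_on hx ?_
    rintro _ ⟨j, rfl⟩
    exact h0 j
  refine ⟨n, fun j => Projective.factorThru (𝟙 P) (biproduct.desc p) ≫ biproduct.π _ j, p, ?_⟩
  simp only [Category.assoc, ← Preadditive.comp_sum]
  rw [← biproduct.desc_eq, Projective.factorThru_comp]

instance FiniteProjective.isFlat (P : Rep.{u} k G) [FiniteProjective P] : IsFlat P := by
  obtain ⟨n, q, p, h⟩ := exists_dualBasis P
  let i : P.V →ₗ[k] (Fin n → MonoidAlgebra k G) := LinearMap.pi fun j => (q j).hom.toLinearMap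
  let r : (Fin n → MonoidAlgebra k G) →ₗ[k] P.V :=
    ∑ j, (p j).hom.toLinearMap ∘ₗ LinearMap.proj j
  refine ⟨Module.Flat.of_retract i r ?_⟩
  ext x
  have := congr((Rep.Hom.hom $h) x)
  rw [Rep.sum_hom, Representation.IntertwiningMap.sum_apply] at this
  simpa [i, r] using this

end FiniteProjective

/-! ### Duals of representations -/

section Dual

variable {k : Type} [CommRing k] {G : Type u} [Group G] (w : G →* ℤˣ)

lemma units_smul_smul {M : Type*} [AddCommGroup M] (g : G) (x : M) :
    (w g : ℤ) • (w g : ℤ) • x = x := by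
  rw [smul_smul, ← Units.val_mul, Int.units_mul_self, Units.val_one, one_smul]

/-- The conjugate dual of a left `k[G]`-module `P`: the group `Hom(P, k[G])`, where `g` acts by
`g • φ = w(g) φ g⁻¹`. -/
abbrev dual (P : Rep.{u} k G) : Rep.{u} k G :=
  Rep.of (X := P ⟶ groupRing k G)
    { toFun := fun g =>
        { toFun := fun φ => (w g : ℤ) • (φ ≫ rightMul k g⁻¹)
          map_add' := by intros; simp
          map_smul' := by
            intro a φ
            simp only [Linear.smul_comp, RingHom.id_apply]
            exact smul_comm _ _ _ }
      map_one' := by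
        ext1 φ
        simp [rightMul_one]
      map_mul' := by
        intro g h
        ext1 φ
        simp [rightMul_mul, mul_smul]
        exact smul_comm _ _ _ }

lemma dual_hom_ext {P Y : Rep.{u} k G} {f g : dual w P ⟶ Y}
    (h : ∀ φ : P ⟶ groupRing k G, f.hom φ = g.hom φ) : f = g := by
  ext1
  exact Representation.IntertwiningMap.ext (LinearMap.ext h)

/-- The functoriality of the conjugate dual. -/
abbrev dualMap {P P' : Rep.{u} k G} (f : P ⟶ P') : dual w P' ⟶ dual w P :=
  Rep.ofHom
    { toFun := fun φ => f ≫ φ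
      map_add' := by intros; simp
      map_smul' := by intros; simp
      isIntertwining' := by intro g; ext1 φ; simp }

lemma dual_ρ_apply {P : Rep.{u} k G} (g : G) (φ : P ⟶ groupRing k G) :
    (dual w P).ρ g φ = (w g : ℤ) • (φ ≫ rightMul k g⁻¹) := rfl

/-- An equivariant map out of the dual of `P` turns right multiplications into the action of `G`,
up to signs. -/
lemma hom_dual_comp_rightMul {P Y : Rep.{u} k G} (μ : dual w P ⟶ Y) (φ : P ⟶ groupRing k G)
    (g : G) : μ.hom (φ ≫ rightMul k g) = (w g⁻¹ : ℤ) • Y.ρ g⁻¹ (μ.hom φ) := by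
  rw [← Rep.hom_comm_apply, dual_ρ_apply, inv_inv, map_zsmul, units_smul_smul]

/-- The dual of `k[G]` is free of rank one, generated by the identity. -/
def dualGroupRingIso : groupRing k G ≅ dual w (groupRing k G) :=
  have hm : Mono (Rep.leftRegularHom (dual w (groupRing k G)) (𝟙 _)) := by
    -- The inverse sends a right multiplication `r` to the image of `r(1)` under the anti-involution
    -- `g ↦ w(g) g⁻¹` of the group ring.
    let t : MonoidAlgebra k G →ₗ[k] MonoidAlgebra k G :=
      groupRingLift fun g => (w g⁻¹ : ℤ) • MonoidAlgebra.single g⁻¹ 1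
    have ht (x : MonoidAlgebra k G) :
        t (((Rep.leftRegularHom (dual w (groupRing k G)) (𝟙 _)).hom x).hom
          (MonoidAlgebra.single 1 1)) = x := by
      induction x using MonoidAlgebra.induction_on with
      | of g =>
        rw [MonoidAlgebra.of_apply, groupRing_hom_single (Rep.leftRegularHom (dual w _) _),
          leftRegularHom_one, one_smul, dual_ρ_apply, Category.id_comp, Rep.zsmul_hom,
          Representation.IntertwiningMap.coe_zsmul, Pi.smul_apply, rightMul_single, map_zsmul,
          one_mul, groupRingLift_single, one_smul, inv_inv, units_smul_smul]
      | add x y hx hy =>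
        rw [map_add]
        exact (map_add t _ _).trans (congrArg₂ _ hx hy)
      | smul a x hx =>
        rw [map_smul]
        exact (map_smul t _ _).trans (congrArg _ hx)
    exact (Rep.mono_iff_injective _).2 fun x y h => by rw [← ht x, h, ht y]
  have he : Epi (Rep.leftRegularHom (dual w (groupRing k G)) (𝟙 _)) := by
    refine (Rep.epi_iff_surjective _).2 fun r => ?_
    induction r using groupRing_end_induction with
    | hadd r s hr hs =>
      obtain ⟨x, rfl⟩ := hr
      obtain ⟨y, rfl⟩ := hs
      exact ⟨x + y, map_add _ _ _⟩
    | hsmul a r hr =>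
      obtain ⟨x, rfl⟩ := hr
      exact ⟨a • x, map_smul _ _ _⟩
    | hr g =>
      refine ⟨(w g⁻¹ : ℤ) • MonoidAlgebra.single g⁻¹ 1, ?_⟩
      rw [map_zsmul, groupRing_hom_single, leftRegularHom_one, one_smul, dual_ρ_apply, inv_inv,
        units_smul_smul, Category.id_comp]
  have := isIso_of_mono_of_epi (Rep.leftRegularHom (dual w (groupRing k G)) (𝟙 _))
  asIso (Rep.leftRegularHom (dual w (groupRing k G)) (𝟙 _))

instance projective_dual (P : Rep.{u} k G) [FiniteProjective P] : Projective (dual w P) where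
  factors {E X} f e he := by
    obtain ⟨n, q, p, h⟩ := FiniteProjective.exists_dualBasis P
    have : Projective (dual w (groupRing k G)) :=
      Projective.of_iso (dualGroupRingIso w) inferInstance
    refine ⟨∑ j, dualMap w (p j) ≫ Projective.factorThru (dualMap w (q j) ≫ f) e, ?_⟩
    simp only [Preadditive.sum_comp, Category.assoc, Projective.factorThru_comp]
    ext φ
    rw [Rep.sum_hom]
    have : φ = ∑ j, (q j ≫ p j ≫ φ) := by
      simp only [← Category.assoc, ← Preadditive.sum_comp, h, Category.id_comp]
    conv_rhs => rw [this]
    simp [Representation.IntertwiningMap.sum_apply]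

end Dual

/-! ### Functoriality of cohomology and of tensor products -/

section Functoriality

variable {k : Type} [CommRing k] {G : Type u} [Group G] {n : ℕ}

/-- The map induced on cohomology by a map of coefficients. -/
def cohomologyMap (n : ℕ) {A B : Rep.{u} k G} (f : A ⟶ B) : Cohomology A n →ₗ[k] Cohomology B n :=
  (Ext.mk₀ f).postcompOfLinear k _ (add_zero n)

lemma cohomologyMap_apply {A B : Rep.{u} k G} (f : A ⟶ B) (x : Cohomology A n) :
    cohomologyMap n f x = x.comp (Ext.mk₀ f) (add_zero n) := rfl

lemma cohomologyMap_cohomologyMap {A B D : Rep.{u} k G} (f : A ⟶ B) (g : B ⟶ D)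
    (x : Cohomology A n) : cohomologyMap n g (cohomologyMap n f x) = cohomologyMap n (f ≫ g) x := by
  simp [cohomologyMap_apply]

@[simp]
lemma cohomologyMap_id {A : Rep.{u} k G} (x : Cohomology A n) : cohomologyMap n (𝟙 A) x = x := by
  simp [cohomologyMap_apply]

lemma cohomologyMap_add {A B : Rep.{u} k G} (f g : A ⟶ B) (x : Cohomology A n) :
    cohomologyMap n (f + g) x = cohomologyMap n f x + cohomologyMap n g x := by
  simp [cohomologyMap_apply, Ext.mk₀_add]

lemma cohomologyMap_neg {A B : Rep.{u} k G} (f : A ⟶ B) (x : Cohomology A n) :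
    cohomologyMap n (-f) x = -cohomologyMap n f x := by
  simp [cohomologyMap_apply, Ext.mk₀_neg]

@[simp]
lemma cohomologyMap_zero {A B : Rep.{u} k G} (x : Cohomology A n) :
    cohomologyMap n (0 : A ⟶ B) x = 0 := by
  simp [cohomologyMap_apply]

lemma cohomologyMap_smul {A B : Rep.{u} k G} (a : k) (f : A ⟶ B) (x : Cohomology A n) :
    cohomologyMap n (a • f) x = a • cohomologyMap n f x := by
  simp [cohomologyMap_apply, Ext.mk₀_smul]

lemma cohomologyMap_zsmul {A B : Rep.{u} k G} (a : ℤ) (f : A ⟶ B) (x : Cohomology A n) :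
    cohomologyMap n (a • f) x = a • cohomologyMap n f x :=
  map_zsmul (AddMonoidHom.mk' (fun f : A ⟶ B => cohomologyMap n f x)
    fun f g => cohomologyMap_add f g x) a f

lemma cohomologyMap_sum {A B : Rep.{u} k G} {ι : Type*} (s : Finset ι) (f : ι → (A ⟶ B))
    (x : Cohomology A n) :
    cohomologyMap n (∑ j ∈ s, f j) x = ∑ j ∈ s, cohomologyMap n (f j) x :=
  map_sum (AddMonoidHom.mk' (fun f : A ⟶ B => cohomologyMap n f x)
    fun f g => cohomologyMap_add f g x) f s

/-- The map `f ⊗ id_X`. -/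
abbrev tensorRightMap {A B : Rep.{u} k G} (f : A ⟶ B) (X : Rep.{u} k G) :
    tensor A X ⟶ tensor B X :=
  (tensorRightFunctor X).map f

lemma tensorRightMap_tmul {A B : Rep.{u} k G} (f : A ⟶ B) (X : Rep.{u} k G) (a : A.V) (x : X.V) :
    (tensorRightMap f X).hom (a ⊗ₜ[k] x) = f.hom a ⊗ₜ[k] x := rfl

lemma tensor_hom_ext {A B Y : Rep.{u} k G} {f g : tensor A B ⟶ Y}
    (h : ∀ a b, f.hom (a ⊗ₜ[k] b) = g.hom (a ⊗ₜ[k] b)) : f = g := by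
  ext1
  apply Representation.IntertwiningMap.ext
  exact TensorProduct.ext' h

lemma tensorRightMap_comp_tensorLeftMap {A B X Y : Rep.{u} k G} (f : A ⟶ B) (g : X ⟶ Y) :
    tensorRightMap f X ≫ tensorLeftMap B g = tensorLeftMap A g ≫ tensorRightMap f Y :=
  tensor_hom_ext fun _ _ => rfl

lemma tensorRightMap_comp {A B D : Rep.{u} k G} (f : A ⟶ B) (g : B ⟶ D) (X : Rep.{u} k G) :
    tensorRightMap (f ≫ g) X = tensorRightMap f X ≫ tensorRightMap g X :=
  (tensorRightFunctor X).map_comp f g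

lemma tensorLeftMap_comp {A B D : Rep.{u} k G} (f : A ⟶ B) (g : B ⟶ D) (X : Rep.{u} k G) :
    tensorLeftMap X (f ≫ g) = tensorLeftMap X f ≫ tensorLeftMap X g :=
  tensor_hom_ext fun _ _ => rfl

lemma tensorRightMap_smul {A B : Rep.{u} k G} (a : k) (f : A ⟶ B) (X : Rep.{u} k G) :
    tensorRightMap (a • f) X = a • tensorRightMap f X :=
  tensor_hom_ext fun _ _ => TensorProduct.smul_tmul' _ _ _

lemma tensorRightMap_add {A B : Rep.{u} k G} (f g : A ⟶ B) (X : Rep.{u} k G) :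
    tensorRightMap (f + g) X = tensorRightMap f X + tensorRightMap g X :=
  (tensorRightFunctor X).map_add

lemma tensorRightMap_zero {A B : Rep.{u} k G} (X : Rep.{u} k G) :
    tensorRightMap (0 : A ⟶ B) X = 0 :=
  (tensorRightFunctor X).map_zero _ _

lemma tensorLeftMap_zero {A B : Rep.{u} k G} (X : Rep.{u} k G) :
    tensorLeftMap X (0 : A ⟶ B) = 0 :=
  tensor_hom_ext fun _ _ => TensorProduct.tmul_zero _ _

/-- The functor `A ⊗ -`. -/
def tensorLeftFunctor (A : Rep.{u} k G) : Rep.{u} k G ⥤ Rep.{u} k G where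
  obj X := tensor A X
  map f := tensorLeftMap A f
  map_id _ := tensor_hom_ext fun _ _ => rfl
  map_comp _ _ := tensor_hom_ext fun _ _ => rfl

/-- The symmetry `X ⊗ A ≅ A ⊗ X`, as an isomorphism of functors in `X`. -/
def tensorCommIso (A : Rep.{u} k G) : tensorRightFunctor A ≅ tensorLeftFunctor A :=
  NatIso.ofComponents (fun X => Rep.mkIso (Representation.TensorProduct.comm X.ρ A.ρ))
    fun _ => tensor_hom_ext fun _ _ => rfl

instance tensorLeftFunctor_additive (A : Rep.{u} k G) : (tensorLeftFunctor A).Additive where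
  map_add {_ _ _ _} := tensor_hom_ext fun _ _ => TensorProduct.tmul_add _ _ _

instance (A : Rep.{u} k G) [IsFlat A] : PreservesFiniteLimits (tensorLeftFunctor A) :=
  preservesFiniteLimits_of_natIso (tensorCommIso A)

instance (A : Rep.{u} k G) [IsFlat A] : PreservesFiniteColimits (tensorLeftFunctor A) :=
  preservesFiniteColimits_of_natIso (tensorCommIso A)

end Functoriality

/-! ### Cohomology with coefficients in `k[G] ⊗ X` -/

section Kappa

variable {k : Type} [CommRing k] {G : Type u} [Group G]

/-- The map `k[G] ⟶ k[G] ⊗ X` of left modules with `1 ↦ 1 ⊗ x`. -/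
def insertRight {X : Rep.{u} k G} (x : X.V) : groupRing k G ⟶ tensor (groupRing k G) X :=
  Rep.leftRegularHom (tensor (groupRing k G) X)
    ((MonoidAlgebra.single 1 1 : MonoidAlgebra k G) ⊗ₜ[k] x)

lemma insertRight_single {X : Rep.{u} k G} (x : X.V) (g : G) :
    (insertRight x).hom (MonoidAlgebra.single g 1) =
      (MonoidAlgebra.single g 1 : MonoidAlgebra k G) ⊗ₜ[k] X.ρ g x := by
  rw [groupRing_hom_single, insertRight, leftRegularHom_one, one_smul]
  simp [Representation.tprod_apply]

lemma insertRight_add {X : Rep.{u} k G} (x y : X.V) :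
    insertRight (x + y) = insertRight x + insertRight y := by
  rw [insertRight, TensorProduct.tmul_add, leftRegularHom_add]
  rfl

lemma insertRight_smul {X : Rep.{u} k G} (a : k) (x : X.V) :
    insertRight (a • x) = a • insertRight x := by
  rw [insertRight, TensorProduct.tmul_smul, leftRegularHom_smul]
  rfl

lemma insertRight_comp_tensorLeftMap {X Y : Rep.{u} k G} (f : X ⟶ Y) (x : X.V) :
    insertRight x ≫ tensorLeftMap _ f = insertRight (f.hom x) := by
  rw [insertRight, leftRegularHom_comp]
  rfl

lemma insertRight_comp_tensorRightMap_rightMul {X : Rep.{u} k G} (g : G) (x : X.V) :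
    insertRight x ≫ tensorRightMap (rightMul k g) X = rightMul k g ≫ insertRight (X.ρ g⁻¹ x) := by
  apply groupRing_hom_ext
  rw [Rep.hom_comp, Rep.hom_comp, Representation.IntertwiningMap.comp_apply,
    Representation.IntertwiningMap.comp_apply, insertRight_single, rightMul_single, one_mul,
    insertRight_single, tensorRightMap_tmul, rightMul_single]
  simp

/-- The maps `k[G] ⟶ k[G] ⊗ X` of left modules are generated by the maps `1 ↦ g ⊗ g x`. -/
lemma groupRing_hom_tensor_induction {X : Rep.{u} k G}
    {motive : (groupRing k G ⟶ tensor (groupRing k G) X) → Prop}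
    (h0 : motive 0) (hadd : ∀ r s, motive r → motive s → motive (r + s))
    (hr : ∀ (r : groupRing k G ⟶ groupRing k G) (x : X.V), motive (r ≫ insertRight x))
    (f : groupRing k G ⟶ tensor (groupRing k G) X) : motive f := by
  obtain ⟨t, rfl⟩ := exists_eq_leftRegularHom f
  have ht (t : MonoidAlgebra k G ⊗[k] X.V) :
      motive (Rep.leftRegularHom (tensor (groupRing k G) X) t) := by
    induction t using TensorProduct.induction_on with
    | zero =>
      convert h0
      exact groupRing_hom_ext (leftRegularHom_one _)
    | add s t hs ht => rw [leftRegularHom_add]; exact hadd _ _ hs ht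
    | tmul a x =>
      induction a using MonoidAlgebra.induction_on generalizing x with
      | of g =>
        convert hr (rightMul k g) (X.ρ g⁻¹ x)
        apply groupRing_hom_ext
        rw [leftRegularHom_one, Rep.hom_comp, Representation.IntertwiningMap.comp_apply,
          rightMul_single, one_mul, insertRight_single]
        simp
      | add a b ha hb =>
        rw [TensorProduct.add_tmul, leftRegularHom_add]; exact hadd _ _ (ha x) (hb x)
      | smul c a ha =>
        rw [TensorProduct.smul_tmul]; exact ha _
  exact ht t

lemma hom_groupRing_tensor_induction {P X : Rep.{u} k G} [FiniteProjective P]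
    {motive : (P ⟶ tensor (groupRing k G) X) → Prop}
    (h0 : motive 0) (hadd : ∀ r s, motive r → motive s → motive (r + s))
    (hr : ∀ (φ : P ⟶ groupRing k G) (x : X.V), motive (φ ≫ insertRight x))
    (f : P ⟶ tensor (groupRing k G) X) : motive f := by
  obtain ⟨n, q, p, h⟩ := FiniteProjective.exists_dualBasis P
  have hf : f = ∑ j, q j ≫ p j ≫ f := by
    simp only [← Category.assoc, ← Preadditive.sum_comp, h, Category.id_comp]
  rw [hf]
  refine Finset.sum_induction _ motive hadd h0 fun j _ => ?_
  induction p j ≫ f using groupRing_hom_tensor_induction with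
  | h0 => simpa using h0
  | hadd r s hr hs => rw [Preadditive.comp_add]; exact hadd _ _ hr hs
  | hr r x => rw [← Category.assoc]; exact hr _ _

variable (w : G →* ℤˣ) {n : ℕ}

/-- The underlying module of `Eⁿ k` is `Hⁿ(G; k[G])`. -/
def conjugateDualEquiv (n : ℕ) :
    (conjugateDual k w n).V ≃ₗ[k] Cohomology (groupRing k G) n :=
  LinearEquiv.refl k (Cohomology (groupRing k G) n)

lemma conjugateDualEquiv_ρ (g : G) (y : (conjugateDual k w n).V) :
    conjugateDualEquiv w n ((conjugateDual k w n).ρ g y) =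
      (w g : ℤ) • cohomologyMap n (rightMul k g⁻¹) (conjugateDualEquiv w n y) := rfl

/-- The comparison map `X ⊗ Eⁿ k → Hⁿ(G; k[G] ⊗ X)`, sending `x ⊗ y` to the image of `y` under the
map of coefficients `1 ↦ 1 ⊗ x`. -/
def kappa (n : ℕ) (X : Rep.{u} k G) :
    X.V ⊗[k] (conjugateDual k w n).V →ₗ[k] Cohomology (tensor (groupRing k G) X) n :=
  TensorProduct.lift <| LinearMap.mk₂ k
    (fun x y => cohomologyMap n (insertRight x) (conjugateDualEquiv w n y))
    (by intros; rw [insertRight_add, cohomologyMap_add])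
    (by intros; rw [insertRight_smul, cohomologyMap_smul])
    (by intros; rw [map_add, map_add])
    (by intros; rw [map_smul, map_smul])

lemma kappa_tmul {X : Rep.{u} k G} (x : X.V) (y : (conjugateDual k w n).V) :
    kappa w n X (x ⊗ₜ[k] y) = cohomologyMap n (insertRight x) (conjugateDualEquiv w n y) := rfl

lemma kappa_tensorRightMap {X Y : Rep.{u} k G} (f : X ⟶ Y)
    (t : X.V ⊗[k] (conjugateDual k w n).V) :
    kappa w n Y ((tensorRightMap f (conjugateDual k w n)).hom t) =
      cohomologyMap n (tensorLeftMap _ f) (kappa w n X t) := by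
  induction t using TensorProduct.induction_on with
  | zero => simp
  | add s t hs ht => simp only [map_add, hs, ht]
  | tmul x y =>
    rw [tensorRightMap_tmul, kappa_tmul, kappa_tmul, cohomologyMap_cohomologyMap,
      insertRight_comp_tensorLeftMap]

/-- The comparison map carries the diagonal action to the conjugate of right multiplication on the
first factor of the coefficients. -/
lemma kappa_ρ {X : Rep.{u} k G} (g : G) (t : X.V ⊗[k] (conjugateDual k w n).V) :
    kappa w n X ((tensor X (conjugateDual k w n)).ρ g t) =
      (w g : ℤ) • cohomologyMap n (tensorRightMap (rightMul k g⁻¹) X) (kappa w n X t) := by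
  induction t using TensorProduct.induction_on with
  | zero => simp
  | add s t hs ht => simp only [map_add, hs, ht, smul_add]
  | tmul x y =>
    change kappa w n X (X.ρ g x ⊗ₜ[k] (conjugateDual k w n).ρ g y) = _
    rw [kappa_tmul, kappa_tmul, cohomologyMap_cohomologyMap,
      insertRight_comp_tensorRightMap_rightMul, inv_inv, conjugateDualEquiv_ρ, map_zsmul,
      cohomologyMap_cohomologyMap]

/-- The map `k[G] ⊗ X → X ⊗ Eⁿ k`, `g ⊗ x ↦ g⁻¹ x ⊗ y g`, for a class `y ∈ Hⁿ(G; k[G])`. Its value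
at `r(1)`, for a map of left modules `r : k[G] ⟶ k[G] ⊗ X`, is a preimage of `r(y)` under the
comparison map `kappa`. -/
def kappaInvAux (X : Rep.{u} k G) (y : Cohomology (groupRing k G) n) :
    MonoidAlgebra k G ⊗[k] X.V →ₗ[k] X.V ⊗[k] (conjugateDual k w n).V :=
  TensorProduct.lift <| groupRingLift fun g =>
    (TensorProduct.mk k X.V (conjugateDual k w n).V).flip
      ((conjugateDualEquiv w n).symm (cohomologyMap n (rightMul k g) y)) ∘ₗ X.ρ g⁻¹

lemma kappaInvAux_apply {X : Rep.{u} k G} (y : Cohomology (groupRing k G) n)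
    (r : groupRing k G ⟶ groupRing k G) (x : X.V) :
    kappaInvAux w X y ((r ≫ insertRight x).hom (MonoidAlgebra.single 1 1)) =
      x ⊗ₜ[k] (conjugateDualEquiv w n).symm (cohomologyMap n r y) := by
  induction r using groupRing_end_induction with
  | hadd r s hr hs =>
    rw [Preadditive.add_comp, cohomologyMap_add, map_add, TensorProduct.tmul_add, ← hr, ← hs]
    exact map_add _ _ _
  | hsmul a r hr =>
    rw [Linear.smul_comp, cohomologyMap_smul, map_smul, TensorProduct.tmul_smul, ← hr]
    exact map_smul (kappaInvAux w X y) a _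
  | hr g =>
    rw [Rep.hom_comp, Representation.IntertwiningMap.comp_apply, rightMul_single, one_mul,
      insertRight_single]
    simp [kappaInvAux]

/-- For a class `y ∈ Hⁿ(G; P)`, a lift of the map `r ↦ r(y)` from `Hom(P, k[G] ⊗ X)` to
`Hⁿ(G; k[G] ⊗ X)` along the comparison map `kappa`. -/
lemma exists_kappaInv {P : Rep.{u} k G} [FiniteProjective P] (X : Rep.{u} k G)
    (y : Cohomology P n) :
    ∃ f : (P ⟶ tensor (groupRing k G) X) →+ X.V ⊗[k] (conjugateDual k w n).V,
      ∀ (φ : P ⟶ groupRing k G) (x : X.V), f (φ ≫ insertRight x) =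
        x ⊗ₜ[k] (conjugateDualEquiv w n).symm (cohomologyMap n φ y) := by
  obtain ⟨m, q, p, h⟩ := FiniteProjective.exists_dualBasis P
  refine ⟨AddMonoidHom.mk' (fun r => ∑ j, kappaInvAux w X (cohomologyMap n (q j) y)
    ((p j ≫ r).hom (MonoidAlgebra.single 1 1))) fun r s => ?_, fun φ x => ?_⟩
  · rw [← Finset.sum_add_distrib]
    refine Finset.sum_congr rfl fun j _ => ?_
    rw [Preadditive.comp_add]
    exact map_add _ _ _
  · have hj (j : Fin m) : kappaInvAux w X (cohomologyMap n (q j) y)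
        ((p j ≫ φ ≫ insertRight x).hom (MonoidAlgebra.single 1 1)) =
          x ⊗ₜ[k] (conjugateDualEquiv w n).symm (cohomologyMap n (q j ≫ p j ≫ φ) y) := by
      rw [← Category.assoc, kappaInvAux_apply, cohomologyMap_cohomologyMap]
    change ∑ j, kappaInvAux w X (cohomologyMap n (q j) y)
      ((p j ≫ φ ≫ insertRight x).hom (MonoidAlgebra.single 1 1)) = _
    rw [Finset.sum_congr rfl fun j _ => hj j, ← TensorProduct.tmul_sum, ← map_sum,
      ← cohomologyMap_sum]
    simp only [← Category.assoc]
    rw [← Preadditive.sum_comp, h, Category.id_comp]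

/-- If `k` has a finitely generated projective resolution of length two then
`X ⊗ E² k ≅ H²(G; k[G] ⊗ X)` for every module `X`. -/
lemma kappa_bijective (R : TwoExtension (augmentationModule k G)) [FiniteProjective R.P₀]
    [FiniteProjective R.P₁] [FiniteProjective R.P₂] (X : Rep.{u} k G) :
    Function.Bijective (kappa w 2 X) := by
  constructor
  · -- A tensor `t` is `f r` for some `r : P₂ ⟶ k[G] ⊗ X` with `r(u) = kappa t`. If `kappa t = 0`
    -- then `r` factors through `P₁`, and `f` vanishes on such maps.
    obtain ⟨f, hf⟩ := exists_kappaInv w X R.cls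
    have h (t : X.V ⊗[k] (conjugateDual k w 2).V) :
        ∃ r, f r = t ∧ cohomologyMap 2 r R.cls = kappa w 2 X t := by
      induction t using TensorProduct.induction_on with
      | zero => exact ⟨0, by simp⟩
      | add s t hs ht =>
        obtain ⟨r, rfl, hr⟩ := hs
        obtain ⟨r', rfl, hr'⟩ := ht
        exact ⟨r + r', map_add _ _ _, by rw [cohomologyMap_add, hr, hr', map_add]⟩
      | tmul x y =>
        obtain ⟨φ, hφ⟩ := R.exists_eq_cls_comp (conjugateDualEquiv w 2 y)
        rw [← cohomologyMap_apply] at hφ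
        refine ⟨φ ≫ insertRight x, ?_, ?_⟩
        · rw [hf, hφ, LinearEquiv.symm_apply_apply]
        · rw [kappa_tmul, ← hφ, cohomologyMap_cohomologyMap]
    refine (injective_iff_map_eq_zero _).2 fun t ht => ?_
    obtain ⟨r, rfl, hr⟩ := h t
    rw [ht] at hr
    obtain ⟨s, rfl⟩ := (R.cls_comp_eq_zero_iff r).1 hr
    clear ht hr
    induction s using hom_groupRing_tensor_induction with
    | h0 => simp
    | hadd r s hr hs => rw [Preadditive.comp_add, map_add, hr, hs, add_zero]
    | hr φ x =>
      rw [← Category.assoc, hf, cohomologyMap_apply, R.cls_comp_d₂, map_zero,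
        TensorProduct.tmul_zero]
  · intro c
    obtain ⟨r, rfl⟩ := R.exists_eq_cls_comp c
    rw [← cohomologyMap_apply]
    induction r using hom_groupRing_tensor_induction with
    | h0 => exact ⟨0, by simp⟩
    | hadd r s hr hs =>
      obtain ⟨a, ha⟩ := hr
      obtain ⟨b, hb⟩ := hs
      exact ⟨a + b, by rw [map_add, ha, hb, cohomologyMap_add]⟩
    | hr φ x =>
      refine ⟨x ⊗ₜ (conjugateDualEquiv w 2).symm (cohomologyMap 2 φ R.cls), ?_⟩
      rw [kappa_tmul, LinearEquiv.apply_symm_apply, cohomologyMap_cohomologyMap]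

end Kappa

/-! ### Maps out of duals as cohomology classes -/

section HomDual

variable {k : Type} [CommRing k] {G : Type u} [Group G] {w : G →* ℤˣ} {n : ℕ}

/-- The map `Hⁿ(G; P ⊗ X) → Hom(P*, X ⊗ Eⁿ k)` that sends `y` to `φ ↦ (φ ⊗ id_X)(y)`. -/
def homDualOfClass {X : Rep.{u} k G} (hX : Function.Bijective (kappa w n X)) {P : Rep.{u} k G}
    (y : Cohomology (tensor P X) n) : dual w P ⟶ tensor X (conjugateDual k w n) :=
  Rep.ofHom
    { toFun := fun φ => (LinearEquiv.ofBijective _ hX).symm (cohomologyMap n (tensorRightMap φ X) y)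
      map_add' := by intro φ ψ; rw [tensorRightMap_add, cohomologyMap_add, map_add]
      map_smul' := by
        intro a φ
        rw [tensorRightMap_smul, cohomologyMap_smul, map_smul, RingHom.id_apply]
      isIntertwining' := by
        intro g
        ext1 φ
        apply hX.1
        refine ((LinearEquiv.ofBijective _ hX).apply_symm_apply _).trans ?_
        refine Eq.trans ?_ (kappa_ρ w g _).symm
        refine Eq.trans ?_ (congrArg (fun z => (w g : ℤ) • cohomologyMap n
          (tensorRightMap (rightMul k g⁻¹) X) z)
          ((LinearEquiv.ofBijective _ hX).apply_symm_apply _).symm)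
        rw [dual_ρ_apply, cohomologyMap_cohomologyMap, ← tensorRightMap_comp,
          ← cohomologyMap_zsmul]
        exact congrArg (fun f => cohomologyMap n f y) (tensorRightFunctor X).map_zsmul }

lemma kappa_homDualOfClass {X : Rep.{u} k G} (hX : Function.Bijective (kappa w n X))
    {P : Rep.{u} k G} (y : Cohomology (tensor P X) n) (φ : P ⟶ groupRing k G) :
    kappa w n X ((homDualOfClass hX y).hom φ) = cohomologyMap n (tensorRightMap φ X) y :=
  (LinearEquiv.ofBijective _ hX).apply_symm_apply _

lemma hom_dual_ext {X : Rep.{u} k G} (hX : Function.Bijective (kappa w n X)) {P : Rep.{u} k G}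
    {f g : dual w P ⟶ tensor X (conjugateDual k w n)}
    (h : ∀ φ : P ⟶ groupRing k G, kappa w n X (f.hom φ) = kappa w n X (g.hom φ)) : f = g :=
  dual_hom_ext w fun φ => hX.1 (h φ)

lemma homDualOfClass_sub {X : Rep.{u} k G} (hX : Function.Bijective (kappa w n X))
    {P : Rep.{u} k G} (y z : Cohomology (tensor P X) n) :
    homDualOfClass hX (y - z) = homDualOfClass hX y - homDualOfClass hX z := by
  refine hom_dual_ext hX fun φ => ?_
  rw [kappa_homDualOfClass, map_sub, ← kappa_homDualOfClass hX, ← kappa_homDualOfClass hX,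
    ← map_sub]
  rfl

lemma dualMap_comp_homDualOfClass {X : Rep.{u} k G} (hX : Function.Bijective (kappa w n X))
    {P P' : Rep.{u} k G} (d : P ⟶ P') (y : Cohomology (tensor P X) n) :
    dualMap w d ≫ homDualOfClass hX y =
      homDualOfClass hX (cohomologyMap n (tensorRightMap d X) y) := by
  refine hom_dual_ext hX fun φ => ?_
  rw [kappa_homDualOfClass, cohomologyMap_cohomologyMap, ← tensorRightMap_comp]
  exact kappa_homDualOfClass hX y (d ≫ φ)

lemma homDualOfClass_comp_tensorRightMap {X Y : Rep.{u} k G}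
    (hX : Function.Bijective (kappa w n X)) (hY : Function.Bijective (kappa w n Y))
    {P : Rep.{u} k G} (f : X ⟶ Y) (y : Cohomology (tensor P X) n) :
    homDualOfClass hX y ≫ tensorRightMap f (conjugateDual k w n) =
      homDualOfClass hY (cohomologyMap n (tensorLeftMap P f) y) := by
  refine hom_dual_ext hY fun φ => ?_
  rw [Rep.hom_comp, Representation.IntertwiningMap.comp_apply, kappa_tensorRightMap,
    kappa_homDualOfClass, kappa_homDualOfClass, cohomologyMap_cohomologyMap,
    cohomologyMap_cohomologyMap, tensorRightMap_comp_tensorLeftMap]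

/-- An equivariant map `μ : P* ⟶ X ⊗ Eⁿ k` is compatible with all endomorphisms of the left module
`k[G]`. -/
lemma kappa_hom_dual_comp {X P : Rep.{u} k G} (μ : dual w P ⟶ tensor X (conjugateDual k w n))
    (φ : P ⟶ groupRing k G) (r : groupRing k G ⟶ groupRing k G) :
    kappa w n X (μ.hom (φ ≫ r)) = cohomologyMap n (tensorRightMap r X) (kappa w n X (μ.hom φ)) := by
  induction r using groupRing_end_induction with
  | hadd r s hr hs =>
    rw [Preadditive.comp_add, tensorRightMap_add, cohomologyMap_add, ← hr, ← hs, ← map_add]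
    exact congrArg _ (map_add _ _ _)
  | hsmul a r hr =>
    rw [Linear.comp_smul, tensorRightMap_smul, cohomologyMap_smul, ← hr, ← map_smul]
    exact congrArg _ (map_smul _ _ _)
  | hr g =>
    rw [hom_dual_comp_rightMul, map_zsmul, kappa_ρ, inv_inv, units_smul_smul]

/-- For `P` finitely generated projective, `Hⁿ(G; P ⊗ X) ≅ Hom(P*, X ⊗ Eⁿ k)`: in terms of a dual
basis `(qⱼ, pⱼ)` of `P`, the inverse sends `μ` to the sum of the images of `μ(qⱼ)` under
`pⱼ ⊗ id_X`. -/
lemma homDualOfClass_bijective {X : Rep.{u} k G} (hX : Function.Bijective (kappa w n X))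
    (P : Rep.{u} k G) [FiniteProjective P] :
    Function.Bijective (homDualOfClass hX (P := P)) := by
  obtain ⟨m, q, p, h⟩ := FiniteProjective.exists_dualBasis P
  constructor
  · intro y y' hy
    have hz (z : Cohomology (tensor P X) n) : z = ∑ j, cohomologyMap n (tensorRightMap (p j) X)
        (kappa w n X ((homDualOfClass hX z).hom (q j))) := by
      have hj (j : Fin m) : cohomologyMap n (tensorRightMap (p j) X)
          (kappa w n X ((homDualOfClass hX z).hom (q j))) =
            cohomologyMap n (tensorRightMap (q j ≫ p j) X) z := by
        rw [kappa_homDualOfClass, cohomologyMap_cohomologyMap, ← tensorRightMap_comp]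
      refine Eq.trans ?_ (Finset.sum_congr rfl fun j _ => (hj j).symm)
      have hs : ∑ j, tensorRightMap (q j ≫ p j) X = 𝟙 (tensor P X) :=
        ((tensorRightFunctor X).map_sum _ _).symm.trans
          ((congrArg (tensorRightFunctor X).map h).trans ((tensorRightFunctor X).map_id P))
      rw [← cohomologyMap_sum, hs, cohomologyMap_id]
    rw [hz y, hy, ← hz y']
  · intro μ
    refine ⟨∑ j, cohomologyMap n (tensorRightMap (p j) X) (kappa w n X (μ.hom (q j))),
      hom_dual_ext hX fun φ => ?_⟩
    have hj (j : Fin m) : cohomologyMap n (tensorRightMap φ X)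
        (cohomologyMap n (tensorRightMap (p j) X) (kappa w n X (μ.hom (q j)))) =
          kappa w n X (μ.hom (q j ≫ p j ≫ φ)) := by
      rw [cohomologyMap_cohomologyMap, ← tensorRightMap_comp, kappa_hom_dual_comp]
    have hφ : φ = ∑ j, q j ≫ p j ≫ φ := by
      simp only [← Category.assoc, ← Preadditive.sum_comp, h, Category.id_comp]
    rw [kappa_homDualOfClass, map_sum, Finset.sum_congr rfl fun j _ => hj j, ← map_sum]
    conv_rhs => rw [hφ]
    exact congrArg _ (map_sum μ.hom _ _).symm

end HomDual

/-! ### The diagonal approximation -/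

section Diagonal

variable {k : Type} [CommRing k] {G : Type u} [Group G]
  (R : TwoExtension (augmentationModule k G))

/-- The canonical isomorphism `A ≅ A ⊗ k`. -/
def rightUnit (A : Rep.{u} k G) : A ≅ tensor A (augmentationModule k G) :=
  leftUnit A ≪≫ Rep.mkIso (Representation.TensorProduct.comm (augmentationModule k G).ρ A.ρ)

/-- The augmentation `id ⊗ ε : A ⊗ P₀ ⟶ A`. -/
def augRight (A : Rep.{u} k G) : tensor A R.P₀ ⟶ A :=
  tensorLeftMap A R.ε ≫ (rightUnit A).inv

/-- The augmentation `ε ⊗ id : P₀ ⊗ A ⟶ A`. -/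
def augLeft (A : Rep.{u} k G) : tensor R.P₀ A ⟶ A :=
  tensorRightMap R.ε A ≫ (leftUnit A).inv

lemma augRight_tmul (A : Rep.{u} k G) (a : A.V) (p : R.P₀.V) :
    (augRight R A).hom (a ⊗ₜ[k] p) = (R.ε.hom p).down • a := rfl

lemma augLeft_tmul (A : Rep.{u} k G) (a : A.V) (p : R.P₀.V) :
    (augLeft R A).hom (p ⊗ₜ[k] a) = (R.ε.hom p).down • a := rfl

lemma tensorRightMap_comp_augRight {A B : Rep.{u} k G} (f : A ⟶ B) :
    tensorRightMap f R.P₀ ≫ augRight R B = augRight R A ≫ f :=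
  tensor_hom_ext fun a p => (map_smul f.hom (R.ε.hom p).down a).symm

lemma tensorLeftMap_comp_augLeft {A B : Rep.{u} k G} (f : A ⟶ B) :
    tensorLeftMap R.P₀ f ≫ augLeft R B = augLeft R A ≫ f :=
  tensor_hom_ext fun p a => (map_smul f.hom (R.ε.hom p).down a).symm

lemma tensorLeftMap_d₁_comp_augRight (A : Rep.{u} k G) :
    tensorLeftMap A R.d₁ ≫ augRight R A = 0 := by
  rw [augRight, ← Category.assoc, ← tensorLeftMap_comp, R.d₁_ε, tensorLeftMap_zero, zero_comp]

lemma tensorRightMap_d₁_comp_augLeft (A : Rep.{u} k G) :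
    tensorRightMap R.d₁ A ≫ augLeft R A = 0 := by
  rw [augLeft, ← Category.assoc, ← tensorRightMap_comp, R.d₁_ε, tensorRightMap_zero, zero_comp]

lemma augRight_comp_ε : augRight R R.P₀ ≫ R.ε = augLeft R R.P₀ ≫ R.ε := by
  refine tensor_hom_ext fun p q => ?_
  rw [Rep.hom_comp, Rep.hom_comp, Representation.IntertwiningMap.comp_apply,
    Representation.IntertwiningMap.comp_apply, augRight_tmul, augLeft_tmul]
  refine (map_smul R.ε.hom _ _).trans (Eq.trans ?_ (map_smul R.ε.hom _ _).symm)
  exact ULift.ext _ _ (mul_comm _ _)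

instance epi_augRight (A : Rep.{u} k G) [IsFlat A] : Epi (augRight R A) := by
  have : Epi (tensorLeftMap A R.ε) := inferInstanceAs (Epi (R.map (tensorLeftFunctor A)).ε)
  exact epi_comp _ _

instance epi_augLeft (A : Rep.{u} k G) [IsFlat A] : Epi (augLeft R A) := by
  have : Epi (tensorRightMap R.ε A) := inferInstanceAs (Epi (R.map (tensorRightFunctor A)).ε)
  exact epi_comp _ _

lemma augLeft_exact (A : Rep.{u} k G) [IsFlat A] :
    (ShortComplex.mk _ _ (tensorRightMap_d₁_comp_augLeft R A)).Exact := by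
  have h := (R.map (tensorRightFunctor A)).exact_d₁_ε
  let e : ShortComplex.mk _ _ (R.map (tensorRightFunctor A)).d₁_ε ⟶
      ShortComplex.mk _ _ (tensorRightMap_d₁_comp_augLeft R A) :=
    { τ₁ := 𝟙 (tensor R.P₁ A)
      τ₂ := 𝟙 (tensor R.P₀ A)
      τ₃ := (leftUnit A).inv
      comm₁₂ := (Category.id_comp _).trans
        ((R.map_d₁ (tensorRightFunctor A)).symm.trans (Category.comp_id _).symm)
      comm₂₃ := Category.id_comp _ }
  have : Epi e.τ₁ := inferInstanceAs (Epi (𝟙 _))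
  have : IsIso e.τ₂ := inferInstanceAs (IsIso (𝟙 _))
  have : Mono e.τ₃ := inferInstanceAs (Mono (leftUnit A).inv)
  exact (ShortComplex.exact_iff_of_epi_of_isIso_of_mono e).1 h

lemma exists_lift_tensorLeftMap_d₁ (A : Rep.{u} k G) [IsFlat A] {X : Rep.{u} k G} [Projective X]
    (f : X ⟶ tensor A R.P₀) (hf : f ≫ augRight R A = 0) :
    ∃ g : X ⟶ tensor A R.P₁, g ≫ tensorLeftMap A R.d₁ = f := by
  have hf' : f ≫ tensorLeftMap A R.ε = 0 := by
    rw [← cancel_mono (rightUnit A).inv, Category.assoc, zero_comp]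
    exact hf
  obtain ⟨g, hg⟩ := (R.map (tensorLeftFunctor A)).exists_lift_d₁ f hf'
  rw [TwoExtension.map_d₁] at hg
  exact ⟨g, hg⟩

lemma exists_lift_tensorLeftMap_d₂ (A : Rep.{u} k G) [IsFlat A] {X : Rep.{u} k G}
    (f : X ⟶ tensor A R.P₁) (hf : f ≫ tensorLeftMap A R.d₁ = 0) :
    ∃ g : X ⟶ tensor A R.P₂, g ≫ tensorLeftMap A R.d₂ = f :=
  (R.map (tensorLeftFunctor A)).exists_lift_d₂ f (by rw [TwoExtension.map_d₁]; exact hf)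

/-- The tensor square of the complex `P` is exact in degree zero. -/
lemma exists_lift_tensor_zero [IsFlat R.P₀] [IsFlat R.P₁] {X : Rep.{u} k G} [Projective X]
    (a : X ⟶ tensor R.P₀ R.P₀) (ha : a ≫ augRight R R.P₀ ≫ R.ε = 0) :
    ∃ (a₁ : X ⟶ tensor R.P₁ R.P₀) (a₂ : X ⟶ tensor R.P₀ R.P₁),
      a = a₁ ≫ tensorRightMap R.d₁ R.P₀ + a₂ ≫ tensorLeftMap R.P₀ R.d₁ := by
  obtain ⟨c, hc⟩ := R.exists_lift_d₁ (a ≫ augRight R R.P₀) (by rw [Category.assoc, ha])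
  let a₁ := Projective.factorThru c (augRight R R.P₁)
  have ha₁ : a₁ ≫ augRight R R.P₁ = c := Projective.factorThru_comp _ _
  obtain ⟨a₂, ha₂⟩ := exists_lift_tensorLeftMap_d₁ R R.P₀ (a - a₁ ≫ tensorRightMap R.d₁ R.P₀) (by
    rw [Preadditive.sub_comp, Category.assoc, tensorRightMap_comp_augRight, ← Category.assoc, ha₁,
      hc, sub_self])
  exact ⟨a₁, a₂, by rw [ha₂, add_sub_cancel]⟩

/-- The tensor square of the complex `P` is exact in degree one. -/
lemma exists_lift_tensor_one [IsFlat R.P₀] [IsFlat R.P₁] [IsFlat R.P₂] {X : Rep.{u} k G}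
    [Projective X] (a₁ : X ⟶ tensor R.P₁ R.P₀) (a₂ : X ⟶ tensor R.P₀ R.P₁)
    (ha : a₁ ≫ tensorRightMap R.d₁ R.P₀ + a₂ ≫ tensorLeftMap R.P₀ R.d₁ = 0) :
    ∃ (b₀ : X ⟶ tensor R.P₂ R.P₀) (b₁ : X ⟶ tensor R.P₁ R.P₁) (b₂ : X ⟶ tensor R.P₀ R.P₂),
      a₁ = b₀ ≫ tensorRightMap R.d₂ R.P₀ + b₁ ≫ tensorLeftMap R.P₁ R.d₁ ∧
        a₂ = b₂ ≫ tensorLeftMap R.P₀ R.d₂ - b₁ ≫ tensorRightMap R.d₁ R.P₁ := by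
  have hz : (a₁ ≫ augRight R R.P₁) ≫ R.d₁ = 0 := by
    have := congr($ha ≫ augRight R R.P₀)
    rwa [Preadditive.add_comp, Category.assoc, Category.assoc, tensorRightMap_comp_augRight,
      tensorLeftMap_d₁_comp_augRight, comp_zero, add_zero, zero_comp, ← Category.assoc] at this
  obtain ⟨c, hc⟩ := R.exists_lift_d₂ _ hz
  let b₀ := Projective.factorThru c (augRight R R.P₂)
  have hb₀ : b₀ ≫ augRight R R.P₂ = c := Projective.factorThru_comp _ _
  obtain ⟨b₁, hb₁⟩ := exists_lift_tensorLeftMap_d₁ R R.P₁ (a₁ - b₀ ≫ tensorRightMap R.d₂ R.P₀) (by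
    rw [Preadditive.sub_comp, Category.assoc, tensorRightMap_comp_augRight, ← Category.assoc, hb₀,
      hc, sub_self])
  have hd : tensorRightMap R.d₂ R.P₀ ≫ tensorRightMap R.d₁ R.P₀ = 0 := by
    rw [← tensorRightMap_comp, R.d₂_d₁, tensorRightMap_zero]
  obtain ⟨b₂, hb₂⟩ := exists_lift_tensorLeftMap_d₂ R R.P₀ (a₂ + b₁ ≫ tensorRightMap R.d₁ R.P₁) (by
    rw [Preadditive.add_comp, Category.assoc, tensorRightMap_comp_tensorLeftMap,
      ← Category.assoc b₁, hb₁, Preadditive.sub_comp, Category.assoc, hd, comp_zero, sub_zero,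
      add_comm, ha])
  exact ⟨b₀, b₁, b₂, by rw [hb₁, add_sub_cancel], by rw [hb₂, add_sub_cancel_right]⟩

/-- The images of the class `u ∈ H²(G; P₂)` of the resolution under the three components in degree
two of a diagonal approximation `P ⟶ P ⊗ P`. -/
lemma exists_diagonal_classes [FiniteProjective R.P₀] [FiniteProjective R.P₁]
    [FiniteProjective R.P₂] :
    ∃ (y₀ : Cohomology (tensor R.P₂ R.P₀) 2) (y₁ : Cohomology (tensor R.P₁ R.P₁) 2)
      (y₂ : Cohomology (tensor R.P₀ R.P₂) 2),
      cohomologyMap 2 (tensorRightMap R.d₂ R.P₀) y₀ =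
        -cohomologyMap 2 (tensorLeftMap R.P₁ R.d₁) y₁ ∧
      cohomologyMap 2 (tensorLeftMap R.P₀ R.d₂) y₂ =
        cohomologyMap 2 (tensorRightMap R.d₁ R.P₁) y₁ ∧
      cohomologyMap 2 (augRight R R.P₂) y₀ = R.cls ∧
      cohomologyMap 2 (augLeft R R.P₂) y₂ = R.cls := by
  obtain ⟨Δ, hΔ⟩ : ∃ Δ : R.P₀ ⟶ tensor R.P₀ R.P₀, Δ ≫ augRight R R.P₀ ≫ R.ε = R.ε :=
    ⟨Projective.factorThru R.ε (augRight R R.P₀ ≫ R.ε), Projective.factorThru_comp _ _⟩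
  obtain ⟨a₁, a₂, ha⟩ := exists_lift_tensor_zero R (R.d₁ ≫ Δ) (by
    rw [Category.assoc, hΔ, R.d₁_ε])
  obtain ⟨b₀, b₁, b₂, h₁, h₂⟩ := exists_lift_tensor_one R (R.d₂ ≫ a₁) (R.d₂ ≫ a₂) (by
    rw [Category.assoc, Category.assoc, ← Preadditive.comp_add, ← ha, ← Category.assoc, R.d₂_d₁,
      zero_comp])
  have h0 {A : Rep.{u} k G} (f : R.P₁ ⟶ A) : cohomologyMap 2 (R.d₂ ≫ f) R.cls = 0 :=
    R.cls_comp_d₂ f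
  refine ⟨cohomologyMap 2 b₀ R.cls, cohomologyMap 2 b₁ R.cls, cohomologyMap 2 b₂ R.cls,
    ?_, ?_, ?_, ?_⟩
  · rw [cohomologyMap_cohomologyMap, cohomologyMap_cohomologyMap, eq_neg_iff_add_eq_zero,
      ← cohomologyMap_add, ← h₁, h0]
  · rw [cohomologyMap_cohomologyMap, cohomologyMap_cohomologyMap, ← sub_eq_zero, sub_eq_add_neg,
      ← cohomologyMap_neg, ← cohomologyMap_add, ← sub_eq_add_neg, ← h₂, h0]
  · -- `(id ⊗ ε) ∘ Δ` is an endomorphism of the resolution over the identity.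
    have n := TwoExtension.cls_naturality (R := R) (R' := R) (f₂ := b₀ ≫ augRight R R.P₂)
      (f₁ := a₁ ≫ augRight R R.P₁) (f₀ := Δ ≫ augRight R R.P₀) (f := 𝟙 _)
      (by
        rw [← Category.assoc, h₁, Preadditive.add_comp, Category.assoc, Category.assoc,
          tensorRightMap_comp_augRight, tensorLeftMap_d₁_comp_augRight, comp_zero, add_zero,
          Category.assoc])
      (by
        rw [← Category.assoc, ha, Preadditive.add_comp, Category.assoc, Category.assoc,
          tensorRightMap_comp_augRight, tensorLeftMap_d₁_comp_augRight, comp_zero, add_zero,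
          Category.assoc])
      (by rw [Category.comp_id, Category.assoc, hΔ])
    rwa [Ext.mk₀_id_comp, ← cohomologyMap_apply, ← cohomologyMap_cohomologyMap] at n
  · -- `(ε ⊗ id) ∘ Δ` is an endomorphism of the resolution over the identity.
    have n := TwoExtension.cls_naturality (R := R) (R' := R) (f₂ := b₂ ≫ augLeft R R.P₂)
      (f₁ := a₂ ≫ augLeft R R.P₁) (f₀ := Δ ≫ augLeft R R.P₀) (f := 𝟙 _)
      (by
        rw [← Category.assoc, h₂, Preadditive.sub_comp, Category.assoc, Category.assoc,
          tensorLeftMap_comp_augLeft, tensorRightMap_d₁_comp_augLeft, comp_zero, sub_zero,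
          Category.assoc])
      (by
        rw [← Category.assoc, ha, Preadditive.add_comp, Category.assoc, Category.assoc,
          tensorLeftMap_comp_augLeft, tensorRightMap_d₁_comp_augLeft, comp_zero, zero_add,
          Category.assoc])
      (by rw [Category.comp_id, Category.assoc, ← augRight_comp_ε, hΔ])
    rwa [Ext.mk₀_id_comp, ← cohomologyMap_apply, ← cohomologyMap_cohomologyMap] at n

end Diagonal

/-! ### The dual resolution -/

section DualResolution

variable {k : Type} [CommRing k] {G : Type u} [Group G]

lemma rep_exact (S : ShortComplex (Rep.{u} k G))
    (h : ∀ x, S.g.hom x = 0 → ∃ y, S.f.hom y = x) : S.Exact := by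
  refine (ShortComplex.exact_map_iff_of_faithful S (forget₂ (Rep.{u} k G) (ModuleCat.{u} k))).1 ?_
  rw [ShortComplex.moduleCat_exact_iff]
  exact h

variable (w : G →* ℤˣ) (R : TwoExtension (augmentationModule k G))

/-- The map `P₂* ⟶ E² k`, `φ ↦ φ(u)`, for the class `u ∈ H²(G; P₂)` of the resolution. -/
def dualAug : dual w R.P₂ ⟶ conjugateDual k w 2 :=
  Rep.ofHom
    { toFun := fun φ => (conjugateDualEquiv w 2).symm (cohomologyMap 2 φ R.cls)
      map_add' := by intros; rw [cohomologyMap_add, map_add]; rfl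
      map_smul' := by intros; rw [cohomologyMap_smul, map_smul, RingHom.id_apply]; rfl
      isIntertwining' := by
        intro g
        ext1 φ
        apply (conjugateDualEquiv w 2).injective
        refine ((conjugateDualEquiv w 2).apply_symm_apply _).trans ?_
        refine Eq.trans ?_ (conjugateDualEquiv_ρ w g _).symm
        refine Eq.trans ?_ (congrArg (fun z => (w g : ℤ) • cohomologyMap 2 (rightMul k g⁻¹) z)
          ((conjugateDualEquiv w 2).apply_symm_apply _).symm)
        rw [dual_ρ_apply, cohomologyMap_cohomologyMap, cohomologyMap_zsmul]
        rfl }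

lemma conjugateDualEquiv_dualAug (φ : R.P₂ ⟶ groupRing k G) :
    conjugateDualEquiv w 2 ((dualAug w R).hom φ) = cohomologyMap 2 φ R.cls :=
  (conjugateDualEquiv w 2).apply_symm_apply _

lemma dualMap_comp {P P' P'' : Rep.{u} k G} (f : P ⟶ P') (g : P' ⟶ P'') :
    dualMap w g ≫ dualMap w f = dualMap w (f ≫ g) :=
  dual_hom_ext w fun φ => (Category.assoc f g φ).symm

lemma dualMap_d₁_d₂ : dualMap w R.d₁ ≫ dualMap w R.d₂ = 0 := by
  rw [dualMap_comp, R.d₂_d₁]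
  exact dual_hom_ext w fun φ => (zero_comp : (0 : R.P₂ ⟶ R.P₀) ≫ φ = 0)

lemma dualMap_d₂_dualAug : dualMap w R.d₂ ≫ dualAug w R = 0 := by
  refine dual_hom_ext w fun φ => (conjugateDualEquiv w 2).injective ?_
  refine (conjugateDualEquiv_dualAug w R (R.d₂ ≫ φ)).trans ?_
  exact (R.cls_comp_d₂ φ).trans (map_zero (conjugateDualEquiv w 2)).symm

lemma dual_exact₁ (h : Subsingleton (Cohomology (groupRing k G) 1)) :
    (ShortComplex.mk _ _ (dualMap_d₁_d₂ w R)).Exact := by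
  refine rep_exact _ fun φ hφ => ?_
  change R.P₁ ⟶ groupRing k G at φ
  change R.d₂ ≫ φ = 0 at hφ
  let ψ : R.B ⟶ groupRing k G := R.exact₁.exact.desc φ hφ
  have hψ : R.p ≫ ψ = φ := R.exact₁.exact.g_desc φ hφ
  obtain ⟨x, hx⟩ := Ext.contravariant_sequence_exact₁ R.exact₀ _ (Ext.mk₀ ψ) (add_zero 1)
    (Subsingleton.elim _ _)
  obtain ⟨χ, rfl⟩ := (Ext.mk₀_bijective _ _).2 x
  refine ⟨χ, ?_⟩
  have hχ : R.i ≫ χ = ψ := (Ext.mk₀_bijective _ _).1 (by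
    rw [← hx]
    exact (Ext.mk₀_comp_mk₀ _ _).symm)
  change R.d₁ ≫ χ = φ
  rw [TwoExtension.d₁, Category.assoc, hχ, hψ]

lemma mono_dualMap_d₁ (h : Subsingleton (Cohomology (groupRing k G) 0)) :
    Mono (dualMap w R.d₁) := by
  refine (Rep.mono_iff_injective _).2 ((injective_iff_map_eq_zero _).2 fun φ hφ => ?_)
  change R.P₀ ⟶ groupRing k G at φ
  change R.d₁ ≫ φ = 0 at hφ
  have hi : R.i ≫ φ = 0 := by
    rw [← cancel_epi R.p, comp_zero, ← Category.assoc]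
    exact hφ
  have hψ : R.ε ≫ R.exact₀.exact.desc φ hi = φ := R.exact₀.exact.g_desc φ hi
  have h0 : R.exact₀.exact.desc φ hi = 0 := (Ext.mk₀_bijective _ _).1 (Subsingleton.elim _ _)
  rw [← hψ, h0, comp_zero]

variable [FiniteProjective R.P₀]

lemma dual_exact₀ : (ShortComplex.mk _ _ (dualMap_d₂_dualAug w R)).Exact := by
  refine rep_exact _ fun φ hφ => ?_
  have h := conjugateDualEquiv_dualAug w R φ
  rw [show (dualAug w R).hom φ = 0 from hφ, map_zero] at h
  exact (R.cls_comp_eq_zero_iff φ).1 h.symm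

variable [FiniteProjective R.P₁]

instance : Epi (dualAug w R) := by
  refine (Rep.epi_iff_surjective _).2 fun y => ?_
  obtain ⟨φ, hφ⟩ := R.exists_eq_cls_comp (conjugateDualEquiv w 2 y)
  refine ⟨φ, (conjugateDualEquiv w 2).injective ?_⟩
  rw [conjugateDualEquiv_dualAug]
  exact hφ

/-- If `Hⁱ(G; k[G]) = 0` for `i < 2` then the dual of the resolution `P` of `k` is a resolution of
`E² k`. -/
def dualResolution (h : ∀ i < 2, Subsingleton (Cohomology (groupRing k G) i)) :
    TwoExtension (conjugateDual k w 2) :=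
  have := mono_dualMap_d₁ w R (h 0 (by norm_num))
  TwoExtension.ofExact (dualMap w R.d₁) (dualMap w R.d₂) (dualAug w R) (dualMap_d₁_d₂ w R)
    (dualMap_d₂_dualAug w R) (dual_exact₁ w R (h 1 (by norm_num))) (dual_exact₀ w R)

lemma dualResolution_d₁ (h : ∀ i < 2, Subsingleton (Cohomology (groupRing k G) i)) :
    (dualResolution w R h).d₁ = dualMap w R.d₂ :=
  have := mono_dualMap_d₁ w R (h 0 (by norm_num))
  TwoExtension.ofExact_d₁ (dualMap w R.d₁) (dualMap w R.d₂) (dualAug w R) (dualMap_d₁_d₂ w R)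
    (dualMap_d₂_dualAug w R) (dual_exact₁ w R (h 1 (by norm_num))) (dual_exact₀ w R)

/-- The class of the dual resolution in `Ext²(E² k, P₀*)`. -/
def dualClass (h : ∀ i < 2, Subsingleton (Cohomology (groupRing k G) i)) :
    Ext.{u} (conjugateDual k w 2) (dual w R.P₀) 2 :=
  (dualResolution w R h).cls

variable [FiniteProjective R.P₂]

lemma exists_eq_dualClass_comp (h : ∀ i < 2, Subsingleton (Cohomology (groupRing k G) i))
    {Y : Rep.{u} k G} (x : Ext.{u} (conjugateDual k w 2) Y 2) :
    ∃ μ : dual w R.P₀ ⟶ Y, (dualClass w R h).comp (Ext.mk₀ μ) (add_zero 2) = x :=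
  have : Projective (dualResolution w R h).P₀ := inferInstanceAs (Projective (dual w R.P₂))
  have : Projective (dualResolution w R h).P₁ := inferInstanceAs (Projective (dual w R.P₁))
  (dualResolution w R h).exists_eq_cls_comp x

lemma dualClass_comp_eq_zero_iff (h : ∀ i < 2, Subsingleton (Cohomology (groupRing k G) i))
    {Y : Rep.{u} k G} (μ : dual w R.P₀ ⟶ Y) :
    (dualClass w R h).comp (Ext.mk₀ μ) (add_zero 2) = 0 ↔
      ∃ ν : dual w R.P₁ ⟶ Y, dualMap w R.d₁ ≫ ν = μ :=
  have : Projective (dualResolution w R h).P₀ := inferInstanceAs (Projective (dual w R.P₂))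
  (dualResolution w R h).cls_comp_eq_zero_iff μ

end DualResolution

/-! ### The cup product with the identity -/

section CupId

variable {k : Type} [CommRing k] {G : Type u} [Group G] (w : G →* ℤˣ)
  (R : TwoExtension (augmentationModule k G)) [FiniteProjective R.P₀] [FiniteProjective R.P₁]
  [FiniteProjective R.P₂]

lemma cup_id {A D : Rep.{u} k G} [IsFlat D] {p : ℕ} (x : Cohomology A p) :
    cup x (𝟙 D) =
      (Ext.mk₀ (leftUnit D).hom).comp (x.mapExactFunctor (tensorRightFunctor D)) (zero_add p) := by
  have h : tensorLeftMap A (𝟙 D) = 𝟙 ((tensorRightFunctor D).obj A) :=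
    tensor_hom_ext fun _ _ => rfl
  have h' : (x.mapExactFunctor (tensorRightFunctor D)).comp (Ext.mk₀ (tensorLeftMap A (𝟙 D)))
      (add_zero p) = x.mapExactFunctor (tensorRightFunctor D) :=
    (congrArg (fun g => (x.mapExactFunctor (tensorRightFunctor D)).comp (Ext.mk₀ g)
      (add_zero p)) h).trans (Ext.comp_mk₀_id _)
  exact congrArg (fun z => (Ext.mk₀ (leftUnit D).hom).comp z (zero_add p)) h'

lemma cup_cohomologyMap {A B D : Rep.{u} k G} [IsFlat D] {p : ℕ} (f : A ⟶ B)
    (x : Cohomology A p) :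
    cup (cohomologyMap p f x) (𝟙 D) =
      (cup x (𝟙 D)).comp (Ext.mk₀ (tensorRightMap f D)) (add_zero p) := by
  rw [cup_id, cup_id, cohomologyMap_apply, Ext.mapExactFunctor_comp, Ext.mapExactFunctor_mk₀]
  exact (Ext.comp_assoc_of_third_deg_zero _ _ _ _).symm

lemma insertRight_up_one :
    insertRight (X := augmentationModule k G) (ULift.up 1) = (rightUnit (groupRing k G)).hom :=
  groupRing_hom_ext (leftRegularHom_one _)

/-- The product of the class `u` of the resolution with the identity of `E² k` is the class of the
dual resolution, followed by the map that corresponds to a component of the diagonal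
approximation. -/
lemma exists_cup_cls_id [IsFlat (conjugateDual k w 2)]
    (h : ∀ i < 2, Subsingleton (Cohomology (groupRing k G) i)) :
    ∃ y : Cohomology (tensor R.P₀ R.P₂) 2, cohomologyMap 2 (augLeft R R.P₂) y = R.cls ∧
      (dualClass w R h).comp (Ext.mk₀ (homDualOfClass (kappa_bijective w R R.P₂) (-y)))
        (add_zero 2) =
      (Ext.mk₀ (leftUnit (conjugateDual k w 2)).hom).comp
        (R.cls.mapExactFunctor (tensorRightFunctor (conjugateDual k w 2))) (zero_add 2) := by
  obtain ⟨y₀, y₁, y₂, h₁, h₂, h₃, h₄⟩ := exists_diagonal_classes R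
  refine ⟨y₂, h₄, ?_⟩
  rw [TwoExtension.mapExactFunctor_cls]
  -- A map from the dual resolution to `P ⊗ E² k` over the identity of `E² k`; the sign of `y₁` is
  -- that of the relation `h₁`, and it forces the sign of `y₂`.
  refine TwoExtension.cls_naturality (R := dualResolution w R h)
    (R' := R.map (tensorRightFunctor (conjugateDual k w 2)))
    (f₁ := homDualOfClass (kappa_bijective w R R.P₁) (-y₁))
    (f₀ := homDualOfClass (kappa_bijective w R R.P₀) y₀) ?_ ?_ ?_
  · refine (dualMap_comp_homDualOfClass _ _ _).trans
      (Eq.trans ?_ (homDualOfClass_comp_tensorRightMap _ (kappa_bijective w R R.P₁) _ _).symm)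
    rw [map_neg, map_neg, h₂]
  · rw [dualResolution_d₁, TwoExtension.map_d₁]
    refine (dualMap_comp_homDualOfClass _ _ _).trans
      (Eq.trans ?_ (homDualOfClass_comp_tensorRightMap _ (kappa_bijective w R R.P₀) _ _).symm)
    rw [h₁, map_neg]
  · change dualAug w R ≫ (leftUnit (conjugateDual k w 2)).hom =
      homDualOfClass _ y₀ ≫ tensorRightMap R.ε (conjugateDual k w 2)
    rw [homDualOfClass_comp_tensorRightMap _ (kappa_bijective w R (augmentationModule k G))]
    refine hom_dual_ext (kappa_bijective w R (augmentationModule k G)) fun φ => ?_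
    have hr : tensorLeftMap R.P₂ R.ε = augRight R R.P₂ ≫ (rightUnit R.P₂).hom := by
      rw [augRight, Category.assoc, Iso.inv_hom_id, Category.comp_id]
    have hφ : (rightUnit R.P₂).hom ≫ tensorRightMap φ (augmentationModule k G) =
        φ ≫ insertRight (X := augmentationModule k G) (ULift.up 1) := by
      rw [insertRight_up_one]
      rfl
    rw [kappa_homDualOfClass, hr, ← cohomologyMap_cohomologyMap, h₃, cohomologyMap_cohomologyMap,
      hφ, ← cohomologyMap_cohomologyMap, ← conjugateDualEquiv_dualAug w]
    exact (kappa_tmul w _ _).symm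

/-- The product with the identity of `E² k` is an isomorphism, for every flat module `A` of
coefficients: with `Ext²(E² k, A ⊗ E² k)` read as a quotient of `H²(G; P₀ ⊗ A)`, the map `ε ⊗ id` to
`H²(G; A)` is its inverse up to sign. -/
theorem cup_id_bijective (R : TwoExtension (augmentationModule k G)) [FiniteProjective R.P₀]
    [FiniteProjective R.P₁] [FiniteProjective R.P₂] [IsFlat (conjugateDual k w 2)]
    (h : ∀ i < 2, Subsingleton (Cohomology (groupRing k G) i)) (A : Rep.{u} k G) [IsFlat A] :
    Function.Bijective
      (fun x : Cohomology A 2 => cup x (𝟙 (conjugateDual k w 2))) := by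
  obtain ⟨y, hy, hc⟩ := exists_cup_cls_id w R h
  have key (f : R.P₂ ⟶ A) : cup (cohomologyMap 2 f R.cls) (𝟙 (conjugateDual k w 2)) =
      (dualClass w R h).comp (Ext.mk₀ (homDualOfClass (kappa_bijective w R A)
        (-cohomologyMap 2 (tensorLeftMap R.P₀ f) y))) (add_zero 2) := by
    rw [cup_cohomologyMap, cup_id, ← hc,
      Ext.comp_assoc_of_third_deg_zero, Ext.mk₀_comp_mk₀,
      homDualOfClass_comp_tensorRightMap _ (kappa_bijective w R A), map_neg]
  have haug (f : R.P₂ ⟶ A) : cohomologyMap 2 (augLeft R A)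
      (cohomologyMap 2 (tensorLeftMap R.P₀ f) y) = cohomologyMap 2 f R.cls := by
    rw [cohomologyMap_cohomologyMap, tensorLeftMap_comp_augLeft, ← cohomologyMap_cohomologyMap, hy]
  constructor
  · refine (injective_iff_map_eq_zero (AddMonoidHom.mk'
      (fun x : Cohomology A 2 => cup x (𝟙 (conjugateDual k w 2)))
        fun a b => cup_add a b _)).2 fun x hx => ?_
    obtain ⟨f, rfl⟩ := R.exists_eq_cls_comp x
    obtain ⟨ν, hν⟩ := (dualClass_comp_eq_zero_iff w R h _).1 ((key f).symm.trans hx)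
    obtain ⟨z, rfl⟩ := (homDualOfClass_bijective (kappa_bijective w R A) R.P₁).2 ν
    rw [dualMap_comp_homDualOfClass] at hν
    have hz := (homDualOfClass_bijective (kappa_bijective w R A) R.P₀).1 hν
    rw [← cohomologyMap_apply, ← haug, ← neg_eq_zero, ← map_neg, ← hz,
      cohomologyMap_cohomologyMap, tensorRightMap_d₁_comp_augLeft, cohomologyMap_zero]
  · intro c
    obtain ⟨μ, rfl⟩ := exists_eq_dualClass_comp w R h c
    obtain ⟨z, rfl⟩ := (homDualOfClass_bijective (kappa_bijective w R A) R.P₀).2 μ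
    obtain ⟨f, hf⟩ := R.exists_eq_cls_comp (-cohomologyMap 2 (augLeft R A) z)
    rw [← cohomologyMap_apply] at hf
    obtain ⟨s, hs⟩ := R.exists_comp_mk₀_eq_of_comp_eq_zero _ (augLeft_exact R A)
      (-cohomologyMap 2 (tensorLeftMap R.P₀ f) y - z) (by
        rw [← cohomologyMap_apply, map_sub, map_neg, haug, hf, neg_neg, sub_self])
    rw [← cohomologyMap_apply] at hs
    refine ⟨cohomologyMap 2 f R.cls, (key f).trans (sub_eq_zero.1 ?_)⟩
    rw [sub_eq_add_neg, ← Ext.comp_neg, ← Ext.comp_add, ← Ext.mk₀_neg, ← Ext.mk₀_add,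
      ← sub_eq_add_neg, ← homDualOfClass_sub, ← hs, ← dualMap_comp_homDualOfClass,
      dualClass_comp_eq_zero_iff]
    exact ⟨_, rfl⟩

end CupId

/-! ### Two-dimensional duality groups -/

section Main

variable {G : Type u} [Group G]

/-- A two-dimensional duality group has a finitely generated projective resolution
`0 ⟶ P₂ ⟶ P₁ ⟶ P₀ ⟶ ℤ ⟶ 0`. -/
lemma IsDualityGroup.exists_twoExtension (hG : IsDualityGroup G 2) :
    ∃ R : TwoExtension (augmentationModule ℤ G), FiniteProjective R.P₀ ∧ FiniteProjective R.P₁ ∧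
      FiniteProjective R.P₂ := by
  obtain ⟨P, hP, hz⟩ := hG.exists_resolution
  have h (i : ℕ) : FiniteProjective (P.complex.X i) :=
    have := hP i
    FiniteProjective.of_finite _
  have : Mono (P.complex.d 2 1) :=
    (P.exact_succ 1).mono_g ((hz 3 (by norm_num)).eq_of_src _ _)
  let ε : P.complex.X 0 ⟶ augmentationModule ℤ G := P.π.f 0
  have : Epi ε := inferInstanceAs (Epi (P.π.f 0))
  exact ⟨TwoExtension.ofExact (P.complex.d 2 1) (P.complex.d 1 0) ε (by simp)
    P.complex_d_comp_π_f_zero (P.exact_succ 0) P.exact₀, h 0, h 1, h 2⟩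

end Main

end DualityGroup

end

theorem mainTheorem3 {G : Type u} [Group G] [Group.IsFinitelyPresented G]
    (hG : DualityGroup.IsDualityGroup G 2) (w : G →* ℤˣ) :
    Function.Bijective (DualityGroup.cupId hG w) := by
  obtain ⟨R, _, _, _⟩ := hG.exists_twoExtension
  have := hG.flat w
  exact DualityGroup.cup_id_bijective w R hG.subsingleton_cohomology _
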